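/- **Setting.** Let $n>1$ and let $\mathscr J^{+},\mathscr J^{-}$ be two partitions of $[1,n]$ into intervals. Let $\pi=\{\alpha_1,\dots,\alpha_{n-1}\}$, $\alpha_i=\varepsilon_i-\varepsilon_{i+1}$, and let $\pi^\pm$ be the set of the $\alpha_i$ such that $i,i+1$ lie in one part of $\mathscr J^\pm$. Assume $\pi^+\cup\pi^-=\pi$ and $\pi^+\cap\pi^-\subsetneq\pi$. A root $\varepsilon_i-\varepsilon_j$ is called *nil* if some $\alpha_k\notin\pi^+\cap\pi^-$ occurs in it. For an interval $J$ let $\kappa_J$ be the reversal of $J$. *Markings.* For each part $J=[c,d]$ of $\mathscr J^+$ (resp. $\mathscr J^-$) and each pair $\{p,q\}$ (possibly $p=q$) with $c\le p,q<d$ and $p+q+1=c+d$, draw a half-integer arc above (resp. below) the line joining $p+\frac12$ and $q+\frac12$. On each connected component of the resulting graph on $\{\frac32,\dots,n-\frac12\}$ mark exactly one arc; if the component has an arc joining a point to itself, the marked arc must be such an arc. An arc $\{p,q\}$, $p\le q$, is recorded as a mark at $p$ on the arc of $\kappa_J$ joining $p$ and $q+1=\kappa_J(p)$. *Modified involutions.*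 An orbit of the group generated by two involutions is called an *edge* if it is also an orbit of the cyclic group generated by their product, and a *loop* otherwise. Let $\sigma^\pm$ be involutions of $[1,n]$ obtained as follows. Let $J=[c,d]$ be a part of $\mathscr J^\pm$, $m=|J|$, $\ell=c+\lfloor m/2\rfloor-1$, and let $M_J\subset[c,\ell]$ be its set of marks. For each maximal interval $[r,s-1]$ of $M_J$ put $L=[r,s-1]$ if $m$ is even and $s-1=\ell$, and $L=[r,s]$ otherwise. On $X=L\cup\kappa_J(L)$ replace $\kappa_J$ by any involution $\sigma$ of $X$ such that $X$ is a single loop (if $s-1<\ell$), resp. a single edge (if $s-1=\ell$), of $\langle\kappa_J|_X,\sigma\rangle$, and such that every $\{x,\sigma(x)\}$ with $\sigma(x)\ne x$ has one element in $L$ and the other in $\kappa_J(L)$. Elsewhere $\sigma^\pm=\kappa_J$ on $J$. *Edges.* Let $E\subset[1,n]$ be an edge of $\langle\sigma^+,\sigma^-\rangle$ with $e=|E|>1$, and let $a\neq b$ be its two elements fixed by $\sigma^+$ or $\sigma^-$ (in either order). Let $\varphi:[1,e]\to E$ be the enumeration of $E$ with $\varphi(1)=a$, obtained by applying $\sigma^-$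 and $\sigma^+$ alternately, beginning with the one that does not fix $a$; so $\varphi(e)=b$. Each pair $p<q$ with $\sigma^+(p)=q$ gives a directed arc $p\to q$, and each pair $p<q$ with $\sigma^-(p)=q$ gives a directed arc $q\to p$. A point $\varphi(t)$, $1<t<e$, is an *internal turning point* if $\varphi(t)-\varphi(t-1)$ and $\varphi(t)-\varphi(t+1)$ have different signs; the *turning points* are these and $a,b$. A turning point is of type $A$ (a source) if all arcs at it point away from it, and of type $B$ (a sink) if all arcs at it point towards it. Write $\beta_t=\varepsilon_{\varphi(t)}-\varepsilon_{\varphi(t+1)}$. The points $\varphi(1),\dots,\varphi(e)$ are ordered from top to bottom; "above", "below", "first", "last" refer to this order. *Signature.* To each internal turning point $\varphi(t)$ assign a marked value: $\beta_{t-1}$ (positive signature) or $\beta_t$ (negative signature). If exactly one of $\beta_{t-1},\beta_t$ is nil, the non-nil one is marked; if both are nil, $\beta_{t-1}$ is marked; if neither is nil, the choice is free. Let $A_-$, $B_-$ be the sets of internal turning points of type $A$, resp. $B$, with negative signature. *Straightening.* For each internal turning point $\varphi(t)$, delete the arc of its marked value, with end points $\varphi(t)$ and $\varphi(w)$ ($w=t-1$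 or $w=t+1$), and replace it by an arc between $\varphi(w)$ and $\varphi(s)$ with the same direction at $\varphi(w)$. If the signature is positive, $\varphi(s)$ is the first turning point of type opposite to $\varphi(t)$ below $\varphi(t)$. If it is negative, $\varphi(s)$ is the first turning point of opposite type below $\varphi(r)$, where $\varphi(r)$ is the lowest turning point strictly above $\varphi(t)$ that is internal, of the same type as $\varphi(t)$ and of negative signature; if there is no such $\varphi(r)$, then $\varphi(s)$ is the first turning point of opposite type. **Proposition 8.2.** The directed arcs so obtained (new arcs and undeleted arcs) form a single directed path $E^*$ through all the points of $E$, the straightened edge. Let $a^*$ be its starting point and $b^*$ its finishing point. 1. $a^*,b^*$ are turning points of $E$, with $a^*$ of type $A$ and $b^*$ of type $B$. 2. If $B_-\neq\emptyset$, then $a^*$ is the turning point immediately after the last element of $B_-$, and it is of type $A$. Otherwise $a^*$ is the first turning point of type $A$. 3. If $A_-\neq\emptyset$, then $b^*$ is the turning point immediately after the last element of $A_-$, and it is of type $B$. Otherwise $b^*$ is the first turning point of type $B$. 4. $a^*=a$ if and only if $a$ is of type $A$ and $B_-=\emptyset$. 5. $a^*=b$ if and only if $b$ is of type $A$ and, in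 case $E$ has an internal turning point, there is an internal turning point of type $B$ and the last one has negative signature. 6. $b^*=a$ if and only if $a$ is of type $B$ and $A_-=\emptyset$. 7. $b^*=b$ if and only if $b$ is of type $B$ and, in case $E$ has an internal turning point, there is an internal turning point of type $A$ and the last one has negative signature. -/

import Mathlib

namespace Biparabolic

/-! ### Double partitions

The sign `true` stands for `+` (above the line `L`), the sign `false` for `-` (below `L`).
The simple root `α_i = ε_i - ε_{i+1}`, `1 ≤ i ≤ n - 1` (equivalently the half-integer point
`i + 1/2` of `L`) is encoded by the integer `i`, so that `π` is `Set.Ico 1 n`. -/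

/-- A double partition `𝒥⁺, 𝒥⁻` of `[1, n]`: two partitions of `[1, n]` into connected subsets. -/
structure DoublePartition (n : ℕ) where
  part : Bool → Finpartition (Finset.Icc (1 : ℤ) n)
  connected : ∀ s, ∀ J ∈ (part s).parts, ∃ lo hi : ℤ, J = Finset.Icc lo hi

/-- `[lo, hi]` is one of the connected components of `𝒥^s`. -/
def DoublePartition.IsComponent {n : ℕ} (P : DoublePartition n) (s : Bool) (lo hi : ℤ) : Prop :=
  lo ≤ hi ∧ Finset.Icc lo hi ∈ (P.part s).parts

/-- The subset `π^s` of simple roots `α_i` such that `i, i + 1` lie in one component of `𝒥^s`. -/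
def DoublePartition.simpleRoots {n : ℕ} (P : DoublePartition n) (s : Bool) : Set ℤ :=
  {i | ∃ lo hi, P.IsComponent s lo hi ∧ lo ≤ i ∧ i + 1 ≤ hi}

/-- The root `ε_i - ε_j` is nil if its support (the set of simple roots `α_k` with
`min i j ≤ k < max i j`) meets `π̂⁺ ∪ π̂⁻`, where `π̂^± = π ∖ π^±`. -/
def DoublePartition.IsNil {n : ℕ} (P : DoublePartition n) (i j : ℤ) : Prop :=
  ∃ k, min i j ≤ k ∧ k < max i j ∧
    k ∈ (Set.Ico (1 : ℤ) n \ P.simpleRoots true) ∪ (Set.Ico (1 : ℤ) n \ P.simpleRoots false)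

/-! ### Markings of half-integer arcs -/

/-- The half-integer arc above (`s = true`) or below (`s = false`) `L` joining the half-integer
points `p + 1/2` and `q + 1/2`: these are exchanged by the diagram automorphism of the component
of `π^s` containing `α_p`. -/
def DoublePartition.HalfArc {n : ℕ} (P : DoublePartition n) (s : Bool) (p q : ℤ) : Prop :=
  ∃ lo hi, P.IsComponent s lo hi ∧ lo ≤ p ∧ p + 1 ≤ hi ∧ p + q + 1 = lo + hi

/-- The (non-fictitious) half-integer arcs, each encoded by its sign and its left end. The arc
`(s, p)` lies directly inside the integer arc of `κ^s` joining `p` to `κ^s(p)`, and represents the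
same root of the Kostant cascade as the latter. -/
def DoublePartition.halfArcs {n : ℕ} (P : DoublePartition n) : Set (Bool × ℤ) :=
  {m | ∃ q, m.2 ≤ q ∧ P.HalfArc m.1 m.2 q}

/-- Two simple roots lie on the same half-integer meander. (The fictitious arcs that complete the
partially defined involutions `ι^±` only join, possibly through one fictitious root, the two free
ends of a meander, or a free end to itself; so they do not enlarge the meanders.) -/
def DoublePartition.SameHalfMeander {n : ℕ} (P : DoublePartition n) : ℤ → ℤ → Prop :=
  Relation.EqvGen fun p q => ∃ s, P.HalfArc s p q

/-- A set of markings: exactly one non-fictitious half-integer arc is marked on each half-integer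
meander; if the meander is an edge, the marked arc joins a fixed point of `ι⁺` or `ι⁻` to itself.
(The half-integer meander, completed by fictitious arcs, is an edge if and only if one of its
non-fictitious arcs joins a point to itself: a fictitious arc joins a point to itself only when
following the meander from that free end leads to a non-fictitious fixed point and back; otherwise
the meander is a loop and any of its non-fictitious arcs may be marked.) -/
def DoublePartition.IsMarking {n : ℕ} (P : DoublePartition n) (M : Set (Bool × ℤ)) : Prop :=
  M ⊆ P.halfArcs ∧
  (∀ p ∈ Set.Ico (1 : ℤ) n, ∃! m, m ∈ M ∧ P.SameHalfMeander p m.2) ∧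
  (∀ m ∈ M, (∃ s p, P.SameHalfMeander m.2 p ∧ P.HalfArc s p p) → P.HalfArc m.1 m.2 m.2)

/-! ### Meanders, loops and edges -/

/-- A meander of two involutions `σ, τ` is an orbit of the group generated by them. -/
def IsMeander (σ τ : Equiv.Perm ℤ) (X : Set ℤ) : Prop :=
  ∃ x, X = MulAction.orbit (Subgroup.closure {σ, τ}) x

/-- An edge is a meander which is also an orbit of the group generated by `σ τ`. -/
def IsEdge (σ τ : Equiv.Perm ℤ) (X : Set ℤ) : Prop :=
  IsMeander σ τ X ∧ ∃ x, X = MulAction.orbit (Subgroup.zpowers (σ * τ)) x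

/-- A loop is a meander which is not an edge. -/
def IsLoop (σ τ : Equiv.Perm ℤ) (X : Set ℤ) : Prop :=
  IsMeander σ τ X ∧ ¬ IsEdge σ τ X

/-! ### Anti-Toeplitz involutions -/

/-- The involution `κ_J` for `J = [lo, hi]`: the reflection of `J`, and the identity outside. -/
def kappa (lo hi : ℤ) : Equiv.Perm ℤ :=
  Function.Involutive.toPerm (fun x => if lo ≤ x ∧ x ≤ hi then lo + hi - x else x) (by
    intro x
    by_cases h : lo ≤ x ∧ x ≤ hi
    · have h' : lo ≤ lo + hi - x ∧ lo + hi - x ≤ hi := by omega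
      simp [h, h']
    · simp [h])

/-- For `J = [lo, hi]` the Kostant cascade consists of the arcs from `i` to `κ_J(i)` with
`lo ≤ i ≤ lastArc lo hi`; this plays the role of the index `[n/2]` for `J = [1, n]`. -/
def lastArc (lo hi : ℤ) : ℤ := lo + (hi - lo + 1) / 2 - 1

/-- `[r, s - 1]` is a connected component of the set `M` of marked arcs of `J = [lo, hi]`. -/
def IsMarkedInterval (lo hi : ℤ) (M : Set ℤ) (r s : ℤ) : Prop :=
  lo ≤ r ∧ r ≤ s - 1 ∧ s - 1 ≤ lastArc lo hi ∧ (∀ i, r ≤ i → i ≤ s - 1 → i ∈ M) ∧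
    (r = lo ∨ r - 1 ∉ M) ∧ (s - 1 = lastArc lo hi ∨ s ∉ M)

/-- The left half `[r, s⁻]` of the extended component attached to `[r, s - 1]`: here
`s⁻ = s - 1` if `|J|` is even and `s - 1` is the last index, and `s⁻ = s` otherwise. -/
def leftHalf (lo hi r s : ℤ) : Set ℤ :=
  if Even (hi - lo + 1) ∧ s - 1 = lastArc lo hi then Set.Icc r (s - 1) else Set.Icc r s

/-- The extended component `ℳ_{r,s} = [r, s⁻] ∪ κ_J([r, s⁻])`. -/
def extended (lo hi r s : ℤ) : Set ℤ :=
  leftHalf lo hi r s ∪ kappa lo hi '' leftHalf lo hi r s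

/-- On `J = [lo, hi]`, with set of marked arcs `M`, the permutation `σ` is obtained from `κ_J` by
replacing, on each extended component, `κ_J` by an anti-Toeplitz involution, that is one with the
properties `T(i)` (single loop or edge through all points) and `T(ii)` (every non-trivial arc joins
the left half to the right half). -/
def IsAntiToeplitz (lo hi : ℤ) (M : Set ℤ) (σ : Equiv.Perm ℤ) : Prop :=
  (∀ r s, IsMarkedInterval lo hi M r s →
    (s - 1 < lastArc lo hi → IsLoop (kappa lo hi) σ (extended lo hi r s)) ∧
    (s - 1 = lastArc lo hi → IsEdge (kappa lo hi) σ (extended lo hi r s)) ∧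
    (∀ x ∈ extended lo hi r s, σ x ≠ x →
      (x ∈ leftHalf lo hi r s ∧ σ x ∈ kappa lo hi '' leftHalf lo hi r s) ∨
      (σ x ∈ leftHalf lo hi r s ∧ x ∈ kappa lo hi '' leftHalf lo hi r s))) ∧
  (∀ x, lo ≤ x → x ≤ hi →
    (∀ r s, IsMarkedInterval lo hi M r s → x ∉ extended lo hi r s) → σ x = kappa lo hi x)

/-- `σ⁺ = σ true` and `σ⁻ = σ false` are modified involutions of `[1, n]` (extended by the identity
to `ℤ`) attached to the double partition `P` and the set `M` of markings. -/
def DoublePartition.IsModified {n : ℕ} (P : DoublePartition n) (M : Set (Bool × ℤ))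
    (σ : Bool → Equiv.Perm ℤ) : Prop :=
  ∀ s, (∀ x, σ s (σ s x) = x) ∧ (∀ x, x ∉ Set.Icc (1 : ℤ) n → σ s x = x) ∧
    ∀ lo hi, P.IsComponent s lo hi → IsAntiToeplitz lo hi {p | (s, p) ∈ M} (σ s)

/-! ### The points, turning points, sources and sinks of an edge

Below, `a` is the starting point and `e` the number of points of an edge of `σ⁺, σ⁻`. The points
`φ(1), …, φ(e)` are placed from top to bottom on the vertical line `V`, and a subset of the edge is
given as a set of positions `t ∈ [1, e]`. -/

/-- The alternating word of length `k` in `σ, τ` starting with `σ` on the right. -/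
def altWord (σ τ : Equiv.Perm ℤ) : ℕ → Equiv.Perm ℤ
  | 0 => 1
  | k + 1 => (if Even k then σ else τ) * altWord σ τ k

open Classical in
/-- The point `φ(t)`, `t ≥ 1`: the word of length `t - 1` applied to `a`, the word starting with
`σ⁻` if `a` is fixed by `σ⁺`, and with `σ⁺` otherwise. -/
noncomputable def phi (σ : Bool → Equiv.Perm ℤ) (a : ℤ) (t : ℕ) : ℤ :=
  if σ true a = a then altWord (σ false) (σ true) (t - 1) a
  else altWord (σ true) (σ false) (t - 1) a

/-- `(p, q)` is a non-trivial directed arc: above `L` arrows point from left to right, below `L`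
from right to left. -/
def DirArc (σ : Bool → Equiv.Perm ℤ) (p q : ℤ) : Prop :=
  (p < q ∧ σ true p = q) ∨ (q < p ∧ σ false p = q)

/-- Positions of the internal turning points. -/
def internalTP (σ : Bool → Equiv.Perm ℤ) (a : ℤ) (e : ℕ) : Set ℕ :=
  {t | 2 ≤ t ∧ t ≤ e - 1 ∧
    Int.sign (phi σ a t - phi σ a (t - 1)) ≠ Int.sign (phi σ a t - phi σ a (t + 1))}

/-- Positions of all turning points: the two end-points and the internal turning points. -/
def turningPoints (σ : Bool → Equiv.Perm ℤ) (a : ℤ) (e : ℕ) : Set ℕ :=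
  {1, e} ∪ internalTP σ a e

/-- The type of a turning point: `TP σ a e true` is the set `A` of sources (every directed arc
meeting the point starts there), `TP σ a e false` is the set `B` of sinks (every directed arc
meeting the point finishes there). -/
def TP (σ : Bool → Equiv.Perm ℤ) (a : ℤ) (e : ℕ) : Bool → Set ℕ
  | true => {t ∈ turningPoints σ a e | ∀ p q, DirArc σ p q →
      (p = phi σ a t ∨ q = phi σ a t) → p = phi σ a t}
  | false => {t ∈ turningPoints σ a e | ∀ p q, DirArc σ p q →
      (p = phi σ a t ∨ q = phi σ a t) → q = phi σ a t}

/-! ### Signatures and the straightened edge -/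

/-- `β_t = ε_{φ(t)} - ε_{φ(t+1)}` is nil. -/
def DoublePartition.NilValue {n : ℕ} (P : DoublePartition n) (σ : Bool → Equiv.Perm ℤ) (a : ℤ)
    (t : ℕ) : Prop :=
  P.IsNil (phi σ a t) (phi σ a (t + 1))

/-- An admissible signature. To each internal turning point `φ(t)` one assigns a marked boundary
value: `sg t = 1` if it is `β_{t-1}` (above `φ(t)`), `sg t = -1` if it is `β_t` (below `φ(t)`).
If exactly one of `β_{t-1}, β_t` is nil the other one is marked, if both are nil `β_{t-1}` is
marked, and if neither is nil either one may be marked. -/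
def DoublePartition.IsSignature {n : ℕ} (P : DoublePartition n) (σ : Bool → Equiv.Perm ℤ) (a : ℤ)
    (e : ℕ) (sg : ℕ → ℤˣ) : Prop :=
  ∀ t ∈ internalTP σ a e,
    (P.NilValue σ a (t - 1) → ¬ P.NilValue σ a t → sg t = -1) ∧
    (¬ P.NilValue σ a (t - 1) → P.NilValue σ a t → sg t = 1) ∧
    (P.NilValue σ a (t - 1) → P.NilValue σ a t → sg t = 1)

/-- The internal turning points of negative signature of type `A` or `B`: `negTP σ a e sg true` is
`A₋` and `negTP σ a e sg false` is `B₋`. -/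
def negTP (σ : Bool → Equiv.Perm ℤ) (a : ℤ) (e : ℕ) (sg : ℕ → ℤˣ) (c : Bool) : Set ℕ :=
  {t | t ∈ internalTP σ a e ∧ t ∈ TP σ a e c ∧ sg t = -1}

/-- The index `i` of the marked value `β_i` assigned to `φ(t)`. -/
def markedIndex (sg : ℕ → ℤˣ) (t : ℕ) : ℕ := if sg t = 1 then t - 1 else t

/-- The position of the end, other than `φ(t)`, of the marked short line assigned to `φ(t)`. -/
def outerEnd (sg : ℕ → ℤˣ) (t : ℕ) : ℕ := if sg t = 1 then t - 1 else t + 1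

/-- The external arc assigned to the internal turning point `φ(t)` of type `c` crosses `φ(s)`.
For positive signature `φ(s)` is the first turning point of the opposite type below `φ(t)`. For
negative signature, if there are turning points of type `c` and negative signature strictly above
`φ(t)` and `φ(r)` is the lowest of them, `φ(s)` is the first turning point of the opposite type
below `φ(r)`; otherwise `φ(s)` is the first turning point of the opposite type. -/
def Crosses (σ : Bool → Equiv.Perm ℤ) (a : ℤ) (e : ℕ) (sg : ℕ → ℤˣ) (c : Bool) (t s : ℕ) : Prop :=
  (sg t = 1 ∧ IsLeast {u ∈ TP σ a e (!c) | t < u} s) ∨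
  (sg t = -1 ∧
    ((∃ r, IsGreatest {r ∈ negTP σ a e sg c | r < t} r ∧ IsLeast {u ∈ TP σ a e (!c) | r < u} s) ∨
     ({r ∈ negTP σ a e sg c | r < t} = ∅ ∧ IsLeast (TP σ a e (!c)) s)))

/-- The directed arcs of the straightened edge: the unmarked short arcs, and, for each internal
turning point `φ(t)`, the external arc which replaces the deleted short arc assigned to `φ(t)`. It
joins the outer end of the deleted arc to the crossed point `φ(s)` and has the same direction as
the deleted arc. -/
def StarArc (σ : Bool → Equiv.Perm ℤ) (a : ℤ) (e : ℕ) (sg : ℕ → ℤˣ) (p q : ℤ) : Prop :=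
  (∃ i, 1 ≤ i ∧ i < e ∧ (∀ t ∈ internalTP σ a e, markedIndex sg t ≠ i) ∧ DirArc σ p q ∧
    ((p = phi σ a i ∧ q = phi σ a (i + 1)) ∨ (p = phi σ a (i + 1) ∧ q = phi σ a i))) ∨
  (∃ t ∈ internalTP σ a e, ∃ c s, t ∈ TP σ a e c ∧ Crosses σ a e sg c t s ∧
    ((DirArc σ (phi σ a t) (phi σ a (outerEnd sg t)) ∧
        p = phi σ a s ∧ q = phi σ a (outerEnd sg t)) ∨
     (DirArc σ (phi σ a (outerEnd sg t)) (phi σ a t) ∧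
        p = phi σ a (outerEnd sg t) ∧ q = phi σ a s)))

/-- `ψ(1), …, ψ(e)` is the straightened edge `E*` of `E`: it passes exactly once through each point
of `E`, and the directed arcs of the straightening are exactly the arcs from `ψ(j)` to `ψ(j + 1)`
(so they form a single edge with all arrows aligned, starting at `ψ(1)` and finishing
at `ψ(e)`). -/
def IsStraightening (σ : Bool → Equiv.Perm ℤ) (a : ℤ) (E : Set ℤ) (sg : ℕ → ℤˣ) (ψ : ℕ → ℤ) :
    Prop :=
  Set.BijOn ψ (Set.Icc 1 E.ncard) E ∧
  ∀ p q, StarArc σ a E.ncard sg p q ↔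
    ∃ j, 1 ≤ j ∧ j < E.ncard ∧ p = ψ j ∧ q = ψ (j + 1)

end Biparabolic

open Biparabolic

/-! Number the points of `E` by their position, so that `E` becomes the path `1, …, m` with an
orientation `d` of its short arcs and a signature `g`. Apart from one geometric input, everything is
combinatorics of such oriented paths, proved by induction on `m` (`starIsPath`).

The invariant is that the straightened arcs form one path whose start is the first source after the
last negative sink, and whose finish is the first sink after the last negative source (`Extremal`;
with no negative point, the first one of all). Reversing all arcs exchanges sources and sinks, so
the new arc may be taken to run from `m + 1` to `m`. If `m` is not a turning point
(`star_succ_straight`), or is one of positive signature (`star_succ_pos`), the point `m + 1` is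
inserted immediately before `m`. If `m` is a turning point of negative signature (`star_succ_neg`),
the arc `m + 1 → m` is replaced by an arc from `m + 1` to the current start, because the crossing
rule is the very rule that defines this start; so `m + 1` is put in front of the whole path.

The positive case needs that no short arc is marked from both its ends. If `t` and `t + 1` are both
internal turning points, the points `φ(t-1), …, φ(t+2)` are monotone, so one and the same involution
moves `φ(t)` and `φ(t+1)` away from each other. By the anti-Toeplitz property an involution moves to
the right only points of the left half of a component, and to the left only points of the right
half; hence `β_t` is nil (`IsModified.isNil`) and the signature at `t` is positive.

The positions of the two ends then follow from the alternation of sources and sinks. -/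

namespace Biparabolic

/-! ### Paths given by lists -/

/-- `i` and `j` are consecutive entries of the list. -/
def Consec {α : Type*} : List α → α → α → Prop
  | [], _, _ => False
  | [_], _, _ => False
  | x :: y :: l, i, j => (i = x ∧ j = y) ∨ Consec (y :: l) i j

theorem consec_append {α : Type*} (l₁ : List α) (x : α) (l₂ : List α) (i j : α) :
    Consec (l₁ ++ x :: l₂) i j ↔ Consec (l₁ ++ [x]) i j ∨ Consec (x :: l₂) i j := by
  induction l₁ with
  | nil => simp [Consec]
  | cons y l ih =>
    cases l with
    | nil => simp [Consec]
    | cons z l => simp only [List.cons_append, Consec] at ih ⊢; rw [ih]; tauto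

theorem Consec.mem {α : Type*} {l : List α} {i j : α} (h : Consec l i j) : i ∈ l ∧ j ∈ l := by
  induction l with
  | nil => exact h.elim
  | cons x l ih =>
    cases l with
    | nil => exact h.elim
    | cons y l =>
      rcases h with ⟨rfl, rfl⟩ | h
      · simp
      · have := ih h
        exact ⟨List.mem_cons_of_mem _ this.1, List.mem_cons_of_mem _ this.2⟩

theorem Consec.mem_tail {α : Type*} {x : α} {l : List α} {i j : α} (h : Consec (x :: l) i j) :
    j ∈ l := by
  cases l with
  | nil => exact h.elim
  | cons y l =>
    rcases h with ⟨rfl, rfl⟩ | h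
    · simp
    · exact h.mem.2

theorem consec_reverse {α : Type*} (l : List α) (i j : α) :
    Consec l.reverse i j ↔ Consec l j i := by
  induction l with
  | nil => simp [Consec]
  | cons x l ih =>
    cases l with
    | nil => simp [Consec]
    | cons y l =>
      simp only [List.reverse_cons, List.append_assoc, List.cons_append, List.nil_append] at ih ⊢
      rw [consec_append, ih]
      simp only [Consec]
      tauto

theorem consec_iff_getElem {α : Type*} (l : List α) (i j : α) :
    Consec l i j ↔ ∃ k, ∃ h : k + 1 < l.length, i = l[k] ∧ j = l[k + 1] := by
  induction l with
  | nil => simp [Consec]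
  | cons x l ih =>
    cases l with
    | nil => simp [Consec]
    | cons y l =>
      simp only [Consec, ih]
      constructor
      · rintro (⟨rfl, rfl⟩ | ⟨k, h, rfl, rfl⟩)
        · exact ⟨0, by simp, rfl, rfl⟩
        · exact ⟨k + 1, by simpa using h, rfl, rfl⟩
      · rintro ⟨k, h, rfl, rfl⟩
        cases k with
        | zero => exact Or.inl ⟨rfl, rfl⟩
        | succ k => exact Or.inr ⟨k, by simpa using h, rfl, rfl⟩

/-- The relation `R` is the successor relation of a single path through the points `1, …, m`,
starting at `s` and finishing at `f`. -/
def IsPathRel (m : ℕ) (R : ℕ → ℕ → Prop) (s f : ℕ) : Prop :=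
  ∃ l : List ℕ, l.Nodup ∧ (∀ x, x ∈ l ↔ 1 ≤ x ∧ x ≤ m) ∧ (∀ i j, R i j ↔ Consec l i j) ∧
    l.head? = some s ∧ l.getLast? = some f

theorem IsPathRel.flip {m : ℕ} {R R' : ℕ → ℕ → Prop} {s f : ℕ} (h : IsPathRel m R s f)
    (hR : ∀ i j, R' i j ↔ R j i) : IsPathRel m R' f s := by
  obtain ⟨l, h1, h2, h3, h4, h5⟩ := h
  refine ⟨l.reverse, List.nodup_reverse.2 h1, by simpa using h2, fun i j => ?_, ?_, ?_⟩
  · rw [hR, h3, consec_reverse]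
  · rw [List.head?_reverse, h5]
  · rw [List.getLast?_reverse, h4]

/-- This is the induction step at a turning point of negative signature. -/
theorem IsPathRel.prepend {m : ℕ} {R R' : ℕ → ℕ → Prop} {s f : ℕ} (h : IsPathRel m R s f)
    (hR : ∀ i j, R' i j ↔ R i j ∨ (i = m + 1 ∧ j = s)) : IsPathRel (m + 1) R' (m + 1) f := by
  obtain ⟨l, h1, h2, h3, h4, h5⟩ := h
  cases l with
  | nil => simp at h4
  | cons y l =>
    obtain rfl : y = s := by simpa using h4
    refine ⟨(m + 1) :: y :: l, List.nodup_cons.2 ⟨?_, h1⟩, ?_, ?_, rfl, ?_⟩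
    · rw [h2]; omega
    · intro x
      rw [List.mem_cons, h2]
      have := (h2 y).1 (by simp)
      omega
    · intro i j
      rw [hR, h3]
      simp only [Consec]
      tauto
    · simpa using h5

/-- This is the induction step in the two other cases, with `x = m`: the new point is placed just
before `x`, and the start changes only when `x` had no predecessor. -/
theorem IsPathRel.insert {m : ℕ} {R R' : ℕ → ℕ → Prop} {s f x : ℕ} (h : IsPathRel m R s f)
    (hx : 1 ≤ x ∧ x ≤ m)
    (hR : ∀ i j, R' i j ↔ (R i j ∧ j ≠ x) ∨ (R i x ∧ j = m + 1) ∨ (i = m + 1 ∧ j = x)) :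
    IsPathRel (m + 1) R' (if s = x then m + 1 else s) f := by
  obtain ⟨l, h1, h2, h3, h4, h5⟩ := h
  obtain ⟨l₁, l₂, rfl⟩ := List.append_of_mem ((h2 x).2 hx)
  have hx2 : x ∉ l₂ := by
    rw [List.nodup_append] at h1
    exact (List.nodup_cons.1 h1.2.1).1
  have hx1 : x ∉ l₁ := by
    rw [List.nodup_append] at h1
    intro hm
    exact h1.2.2 x hm x (by simp) rfl
  refine ⟨l₁ ++ (m + 1) :: x :: l₂, ?_, ?_, ?_, ?_, ?_⟩
  · have hm : m + 1 ∉ l₁ ++ x :: l₂ := by rw [h2]; omega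
    have := List.nodup_middle (a := m + 1) (l₁ := l₁) (l₂ := x :: l₂)
    rw [this]
    exact List.nodup_cons.2 ⟨hm, h1⟩
  · intro y
    have := h2 y
    simp only [List.mem_append, List.mem_cons] at this ⊢
    have : y ∈ l₁ ∨ y = m + 1 ∨ y = x ∨ y ∈ l₂ ↔ y = m + 1 ∨ (1 ≤ y ∧ y ≤ m) := by
      rw [← this]; tauto
    rw [this]; omega
  · intro i j
    rw [hR, h3, h3]
    have e2 : ∀ i j, Consec (x :: l₂) i j → j ≠ x := by
      rintro i j h rfl
      exact hx2 h.mem_tail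
    -- Either `x` is the head and no arc is broken, or the arc from its predecessor `z` is
    -- redirected to `m + 1`.
    rcases List.eq_nil_or_concat l₁ with rfl | ⟨l₃, z, rfl⟩
    · simp only [List.nil_append, Consec]
      have := e2 i j
      have := e2 i x
      tauto
    · simp only [List.concat_eq_append, List.append_assoc, List.cons_append, List.nil_append]
      rw [consec_append, consec_append l₃ z (x :: l₂) i x,
        consec_append l₃ z ((m + 1) :: x :: l₂)]
      simp only [Consec]
      have e1 : ∀ i j, Consec (l₃ ++ [z]) i j → j ≠ x := by
        rintro i j h rfl
        exact hx1 (by simpa using h.mem.2)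
      have := e2 i j
      have := e2 i x
      have := e1 i j
      have := e1 i x
      clear h1 h2 h3 h4 h5 hR hx hx1 hx2 e1 e2
      by_cases hj : j = x <;> simp_all ; tauto
  · cases l₁ with
    | nil =>
      have : x = s := by simpa using h4
      simp [this]
    | cons y l₁ =>
      have : y = s := by simpa using h4
      subst this
      have : y ≠ x := by rintro rfl; simp at hx1
      simp [this]
  · rw [← h5]; simp

/-! ### Orientations of the path `1 — 2 — ⋯ — m`

The arc between `t` and `t + 1` points from `t` to `t + 1` if `d t = true`, and from `t + 1` to `t`
otherwise. -/

/-- `t` is an internal turning point of the orientation `d` of the path `1, …, m`. -/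
def Turn (d : ℕ → Bool) (m t : ℕ) : Prop := 2 ≤ t ∧ t < m ∧ d (t - 1) ≠ d t

/-- `t` is a source (`c = true`) or a sink (`c = false`) of the orientation `d`. -/
def Typ (d : ℕ → Bool) (m : ℕ) (c : Bool) (t : ℕ) : Prop :=
  1 ≤ t ∧ t ≤ m ∧ (2 ≤ t → d (t - 1) = !c) ∧ (t < m → d t = c)

/-- `t` is an internal turning point of type `c` and of negative signature. -/
def Neg (d : ℕ → Bool) (g : ℕ → ℤˣ) (c : Bool) (t : ℕ) : Prop :=
  2 ≤ t ∧ d (t - 1) ≠ d t ∧ d t = c ∧ g t = -1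

/-- `r` is the last internal turning point before `t` of type `c` and of negative signature, or
`0` if there is none. -/
def LastNeg (d : ℕ → Bool) (g : ℕ → ℤˣ) (c : Bool) (t r : ℕ) : Prop :=
  IsGreatest {r | Neg d g c r ∧ r < t} r ∨ ({r | Neg d g c r ∧ r < t} = ∅ ∧ r = 0)

/-- `s` is the first turning point of type `c` after `r`. -/
def First (d : ℕ → Bool) (m : ℕ) (c : Bool) (r s : ℕ) : Prop :=
  IsLeast {u | Typ d m c u ∧ r < u} s

/-- `s` is the point crossed by the external arc assigned to the internal turning point `t`. -/
def Cross (d : ℕ → Bool) (g : ℕ → ℤˣ) (m t s : ℕ) : Prop :=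
  (g t = 1 ∧ First d m (!d t) t s) ∨ (g t = -1 ∧ ∃ r, LastNeg d g (d t) t r ∧ First d m (!d t) r s)

/-- The directed arcs of the straightening of the path `1, …, m`. -/
def Star (d : ℕ → Bool) (g : ℕ → ℤˣ) (m i j : ℕ) : Prop :=
  (∃ k, 1 ≤ k ∧ k < m ∧ (∀ t, Turn d m t → markedIndex g t ≠ k) ∧
    ((d k = true ∧ i = k ∧ j = k + 1) ∨ (d k = false ∧ i = k + 1 ∧ j = k))) ∨
  (∃ t s, Turn d m t ∧ Cross d g m t s ∧
    ((d t = true ∧ i = s ∧ j = outerEnd g t) ∨ (d t = false ∧ i = outerEnd g t ∧ j = s)))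

/-- The candidate for the end of type `c` of the straightened path. -/
def Extremal (d : ℕ → Bool) (g : ℕ → ℤˣ) (m : ℕ) (c : Bool) (s : ℕ) : Prop :=
  ∃ r, LastNeg d g (!c) m r ∧ First d m c r s

/-! ### Reversal of all arcs -/

section dual

variable (d : ℕ → Bool) (g : ℕ → ℤˣ) (m : ℕ)

theorem turn_not (t : ℕ) : Turn (fun i => !d i) m t ↔ Turn d m t := by
  simp [Turn]

theorem typ_not (c : Bool) (t : ℕ) : Typ (fun i => !d i) m c t ↔ Typ d m (!c) t := by
  cases c <;> simp [Typ]

theorem neg_not (c : Bool) (t : ℕ) : Neg (fun i => !d i) g c t ↔ Neg d g (!c) t := by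
  cases c <;> simp [Neg]

theorem lastNeg_not (c : Bool) (t r : ℕ) :
    LastNeg (fun i => !d i) g c t r ↔ LastNeg d g (!c) t r := by
  simp only [LastNeg, neg_not]

theorem first_not (c : Bool) (r s : ℕ) :
    First (fun i => !d i) m c r s ↔ First d m (!c) r s := by
  simp only [First, typ_not]

theorem cross_not (t s : ℕ) : Cross (fun i => !d i) g m t s ↔ Cross d g m t s := by
  simp only [Cross, first_not, lastNeg_not, Bool.not_not]

theorem star_not (i j : ℕ) : Star (fun i => !d i) g m i j ↔ Star d g m j i := by
  simp only [Star, turn_not, cross_not, Bool.not_eq_true', Bool.not_eq_false']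
  refine or_congr ?_ ?_
  · refine exists_congr fun k => ?_
    tauto
  · refine exists_congr fun t => exists_congr fun s => ?_
    tauto

theorem extremal_not (c : Bool) (s : ℕ) :
    Extremal (fun i => !d i) g m c s ↔ Extremal d g m (!c) s := by
  simp only [Extremal, lastNeg_not, first_not]

end dual

/-! ### Existence and uniqueness of the next turning point of a given type -/

section straighten

variable {d : ℕ → Bool} {g : ℕ → ℤˣ} {m : ℕ}

/-- Follow the arcs from `r` until the orientation becomes `c` or the path ends. All arcs passed
have orientation `!c`, so the stopping point has type `c`, as an internal turning point or as the
end `m`. -/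
theorem exists_first {c : Bool} {r : ℕ} (hr : 1 ≤ r) (hrm : r < m) (hd : d r = !c) :
    ∃ s, First d m c r s := by
  classical
  have hex : ∃ u, r < u ∧ (u = m ∨ d u = c) := ⟨m, hrm, Or.inl rfl⟩
  obtain ⟨h1, h2⟩ := Nat.find_spec hex
  have hmin := fun v (hv : v < Nat.find hex) => Nat.find_min hex hv
  set u := Nat.find hex
  have hum : u ≤ m := by
    by_contra h
    exact hmin m (by omega) ⟨hrm, Or.inl rfl⟩
  have hprev : ∀ v, r ≤ v → v < u → d v = !c := by
    intro v hv hvu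
    rcases hv.eq_or_lt with rfl | hv
    · exact hd
    · have := hmin v hvu
      simp only [not_and, not_or] at this
      have := (this hv).2
      revert this; cases d v <;> cases c <;> simp
  refine ⟨u, ⟨⟨by omega, hum, fun _ => hprev _ (by omega) (by omega), fun h => ?_⟩, h1⟩, ?_⟩
  · rcases h2 with h2 | h2
    · omega
    · exact h2
  · rintro v ⟨⟨hv1, hv2, hv3, hv4⟩, hv⟩
    by_contra hlt
    have h5 := hprev v hv.le (by omega)
    rw [hv4 (by omega)] at h5
    revert h5; cases c <;> simp

theorem exists_first_zero (hm : 2 ≤ m) (c : Bool) : ∃ s, First d m c 0 s := by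
  by_cases h : d 1 = c
  · exact ⟨1, ⟨⟨le_rfl, by omega, by omega, fun _ => h⟩, by omega⟩, fun v hv => hv.2⟩
  · have h' : d 1 = !c := by revert h; cases d 1 <;> cases c <;> simp
    obtain ⟨s, hs⟩ := exists_first (c := c) le_rfl (by omega : 1 < m) h'
    refine ⟨s, ⟨hs.1.1, by have := hs.1.2; omega⟩, fun v hv => hs.2 ⟨hv.1, ?_⟩⟩
    have hv0 := hv.2
    have hv1 := hv.1.2.2.2
    by_contra hlt
    obtain rfl : v = 1 := by omega
    exact h (hv1 (by omega))

theorem First.unique {c : Bool} {r s s' : ℕ} (h : First d m c r s) (h' : First d m c r s') :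
    s = s' := IsLeast.unique h h'

/-- The last negative turning point is either `0` or a point after which the path goes on to a
turning point of opposite type. -/
theorem LastNeg.exists_first {c : Bool} {t r : ℕ} (hm : 2 ≤ m) (htm : t ≤ m)
    (h : LastNeg d g c t r) : r < m ∧ ∃ s, First d m (!c) r s := by
  rcases h with h | ⟨-, rfl⟩
  · obtain ⟨⟨h1, h2, h3, h4⟩, h5⟩ := h.1
    exact ⟨by omega, Biparabolic.exists_first (by omega) (by omega) (by simpa using h3)⟩
  · exact ⟨by omega, exists_first_zero hm _⟩

/-! Adding the point `m + 1`, which lies after an internal turning point. -/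

theorem Turn.succ_iff {t : ℕ} (hm : 2 ≤ m) (hd : d (m - 1) ≠ d m) :
    Turn d (m + 1) t ↔ Turn d m t ∨ t = m := by
  unfold Turn
  constructor
  · rintro ⟨h1, h2, h3⟩
    by_cases h : t = m
    · exact Or.inr h
    · exact Or.inl ⟨h1, by omega, h3⟩
  · rintro (⟨h1, h2, h3⟩ | rfl)
    · exact ⟨h1, by omega, h3⟩
    · exact ⟨hm, by omega, hd⟩

theorem typ_succ_turn {c : Bool} {t : ℕ} (hm : 2 ≤ m) (hd : d (m - 1) ≠ d m) :
    Typ d (m + 1) c t ↔ Typ d m c t ∨ (t = m + 1 ∧ c = !d m) := by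
  unfold Typ
  rcases lt_trichotomy t m with h | rfl | h
  · have : t < m + 1 := by omega
    have : t ≠ m + 1 := by omega
    simp [*, h.le, (by omega : t ≤ m + 1)]
  · simp only [le_refl, lt_self_iff_false, hm, (by omega : t ≤ t + 1), (by omega : t < t + 1)]
    revert hd; cases d (t - 1) <;> cases d t <;> cases c <;> simp
  · constructor
    · rintro ⟨h1, h2, h3, h4⟩
      obtain rfl : t = m + 1 := by omega
      have := h3 (by omega)
      simp only [Nat.add_sub_cancel] at this
      right; simp [this]
    · rintro (⟨h1, h2, -⟩ | ⟨rfl, rfl⟩)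
      · omega
      · simp

/-- The end `m` keeps its type when it becomes an internal turning point, and the new turning point
`m + 1` comes after all others; so a search that already succeeded is not affected. -/
theorem first_succ_turn {c : Bool} {r s : ℕ} (hm : 2 ≤ m) (hd : d (m - 1) ≠ d m)
    (hex : ∃ s, First d m c r s) : First d (m + 1) c r s ↔ First d m c r s := by
  obtain ⟨s', hs'⟩ := hex
  have h : First d (m + 1) c r s' := by
    refine ⟨⟨(typ_succ_turn hm hd).2 (Or.inl hs'.1.1), hs'.1.2⟩, ?_⟩
    rintro v ⟨hv, hrv⟩
    rcases (typ_succ_turn hm hd).1 hv with hv | ⟨rfl, -⟩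
    · exact hs'.2 ⟨hv, hrv⟩
    · have := hs'.1.1.2.1; omega
  exact ⟨fun h' => h'.unique h ▸ hs', fun h' => h'.unique hs' ▸ h⟩

theorem cross_succ_turn {t s : ℕ} (hm : 2 ≤ m) (hd : d (m - 1) ≠ d m) (ht : Turn d m t) :
    Cross d g (m + 1) t s ↔ Cross d g m t s := by
  unfold Cross
  refine or_congr (and_congr_right fun _ => ?_) (and_congr_right fun _ => exists_congr fun r =>
    and_congr_right fun hr => ?_)
  · exact first_succ_turn hm hd (exists_first (by have := ht.1; omega) ht.2.1 (by simp))
  · exact first_succ_turn hm hd (hr.exists_first hm ht.2.1.le).2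

/-! Adding the point `m + 1`, which lies after a point which is not a turning point. -/

theorem turn_succ_straight {t : ℕ} (hd : d (m - 1) = d m) :
    Turn d (m + 1) t ↔ Turn d m t := by
  unfold Turn
  constructor
  · rintro ⟨h1, h2, h3⟩
    refine ⟨h1, ?_, h3⟩
    by_contra h
    obtain rfl : t = m := by omega
    exact h3 hd
  · rintro ⟨h1, h2, h3⟩
    exact ⟨h1, by omega, h3⟩

theorem typ_succ_straight {c : Bool} {t : ℕ} (hm : 2 ≤ m) (hd : d (m - 1) = d m) :
    Typ d (m + 1) c t ↔ (Typ d m c t ∧ t ≠ m) ∨ (t = m + 1 ∧ c = !d m) := by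
  unfold Typ
  rcases lt_trichotomy t m with h | rfl | h
  · have : t < m + 1 := by omega
    have : t ≠ m + 1 := by omega
    simp [*, h.le, h.ne, (by omega : t ≤ m + 1)]
  · simp only [le_refl, lt_self_iff_false, hm, (by omega : t ≤ t + 1), (by omega : t < t + 1)]
    revert hd; cases d (t - 1) <;> cases d t <;> cases c <;> simp
  · constructor
    · rintro ⟨h1, h2, h3, h4⟩
      obtain rfl : t = m + 1 := by omega
      have := h3 (by omega)
      simp only [Nat.add_sub_cancel] at this
      right; simp [this]
    · rintro (⟨⟨h1, h2, -⟩, -⟩ | ⟨rfl, rfl⟩)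
      · omega
      · simp

theorem typ_last {c : Bool} (hm : 2 ≤ m) (hd : d (m - 1) = d m) : Typ d m c m ↔ c = !d m := by
  unfold Typ
  simp only [le_refl, lt_self_iff_false, hm, hd, (by omega : 1 ≤ m)]
  cases d m <;> cases c <;> simp

/-- The role of `m` as an end passes, with the same type, to `m + 1`, while `m` stops being a
turning point. -/
theorem First.succ_straight {c : Bool} {r s : ℕ} (hm : 2 ≤ m) (hd : d (m - 1) = d m)
    (h : First d m c r s) : First d (m + 1) c r (if s = m then m + 1 else s) := by
  have hs := h.1.1.2.1
  split_ifs with hsm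
  · subst hsm
    refine ⟨⟨(typ_succ_straight hm hd).2 (Or.inr ⟨rfl, (typ_last hm hd).1 h.1.1⟩), ?_⟩, ?_⟩
    · exact Nat.lt_succ_of_lt h.1.2
    · rintro v ⟨hv, hrv⟩
      rcases (typ_succ_straight hm hd).1 hv with ⟨hv, hvm⟩ | ⟨rfl, -⟩
      · have := h.2 ⟨hv, hrv⟩; omega
      · exact le_rfl
  · refine ⟨⟨(typ_succ_straight hm hd).2 (Or.inl ⟨h.1.1, hsm⟩), h.1.2⟩, ?_⟩
    rintro v ⟨hv, hrv⟩
    rcases (typ_succ_straight hm hd).1 hv with ⟨hv, hvm⟩ | ⟨rfl, -⟩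
    · exact h.2 ⟨hv, hrv⟩
    · omega

theorem first_succ_straight {c : Bool} {r s : ℕ} (hm : 2 ≤ m) (hd : d (m - 1) = d m)
    (hex : ∃ s, First d m c r s) :
    First d (m + 1) c r s ↔ ∃ s', First d m c r s' ∧ s = if s' = m then m + 1 else s' := by
  constructor
  · intro h
    obtain ⟨s', hs'⟩ := hex
    exact ⟨s', hs', h.unique (hs'.succ_straight hm hd)⟩
  · rintro ⟨s', hs', rfl⟩
    exact hs'.succ_straight hm hd

theorem cross_succ_straight {t s : ℕ} (hm : 2 ≤ m) (hd : d (m - 1) = d m) (ht : Turn d m t) :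
    Cross d g (m + 1) t s ↔ ∃ s', Cross d g m t s' ∧ s = if s' = m then m + 1 else s' := by
  have e1 : ∀ s, First d (m + 1) (!d t) t s ↔ _ := fun s =>
    first_succ_straight hm hd (exists_first (by have := ht.1; omega) ht.2.1 (by simp))
  have e2 : ∀ r, LastNeg d g (d t) t r → ∀ s, (First d (m + 1) (!d t) r s ↔ _) := fun r hr s =>
    first_succ_straight hm hd (hr.exists_first hm ht.2.1.le).2
  unfold Cross
  constructor
  · rintro (⟨hg, h⟩ | ⟨hg, r, hr, h⟩)
    · obtain ⟨s', h1, h2⟩ := (e1 s).1 h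
      exact ⟨s', Or.inl ⟨hg, h1⟩, h2⟩
    · obtain ⟨s', h1, h2⟩ := (e2 r hr s).1 h
      exact ⟨s', Or.inr ⟨hg, r, hr, h1⟩, h2⟩
  · rintro ⟨s', ⟨hg, h⟩ | ⟨hg, r, hr, h⟩, h2⟩
    · exact Or.inl ⟨hg, (e1 s).2 ⟨s', h, h2⟩⟩
    · exact Or.inr ⟨hg, r, hr, (e2 r hr s).2 ⟨s', h, h2⟩⟩

/-! ### Effect of one more point on the straightened arcs -/

theorem Cross.typ {t s : ℕ} (h : Cross d g m t s) : Typ d m (!d t) s := by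
  rcases h with ⟨-, h⟩ | ⟨-, r, -, h⟩ <;> exact h.1.1

theorem markedIndex_le (g : ℕ → ℤˣ) (t : ℕ) : markedIndex g t ≤ t := by
  unfold markedIndex; split_ifs <;> omega

theorem outerEnd_eq_of_lt {t : ℕ} (htm : t < m) (h : outerEnd g t = m) : t + 1 = m ∧ g t ≠ 1 := by
  unfold outerEnd at h
  split_ifs at h with h1
  · omega
  · exact ⟨h, h1⟩

theorem lastNeg_unique {c : Bool} {t r r' : ℕ} (h : LastNeg d g c t r) (h' : LastNeg d g c t r') :
    r = r' := by
  rcases h with h | ⟨h, rfl⟩ <;> rcases h' with h' | ⟨h', rfl⟩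
  · exact h.unique h'
  · exact absurd h.1 (by rw [h']; simp)
  · exact absurd h'.1 (by rw [h]; simp)
  · rfl

theorem Extremal.unique {c : Bool} {s s' : ℕ} (h : Extremal d g m c s)
    (h' : Extremal d g m c s') : s = s' := by
  obtain ⟨r, hr, h⟩ := h
  obtain ⟨r', hr', h'⟩ := h'
  obtain rfl := lastNeg_unique hr hr'
  exact h.unique h'

/-- The end `m` is a source, so the only old arcs into it are external arcs that cross it. These now
cross `m + 1`, and the short arc `m + 1 → m` is unmarked. -/
theorem star_succ_straight (hm : 2 ≤ m) (hd : d (m - 1) = false) (hdm : d m = false) (i j : ℕ) :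
    Star d g (m + 1) i j ↔ (Star d g m i j ∧ j ≠ m) ∨ (Star d g m i m ∧ j = m + 1) ∨
      (i = m + 1 ∧ j = m) := by
  have hdd : d (m - 1) = d m := by rw [hd, hdm]
  have hout : ∀ t, Turn d m t → d t = true → outerEnd g t ≠ m := by
    intro t ht hdt h
    have := (outerEnd_eq_of_lt ht.2.1 h).1
    rw [show t = m - 1 by omega, hd] at hdt
    simp at hdt
  have htyp : ∀ t s, Cross d g m t s → d t = true → s ≠ m := by
    rintro t s h hdt rfl
    have := (typ_last hm hdd).1 h.typ
    simp [hdt, hdm] at this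
  constructor
  · rintro (⟨k, h1, h2, h3, h4⟩ | ⟨t, s, ht, hs, h⟩)
    · rcases Nat.lt_succ_iff_lt_or_eq.1 h2 with hk | rfl
      · refine Or.inl ⟨Or.inl ⟨k, h1, hk, fun t ht => h3 t ((turn_succ_straight hdd).2 ht), h4⟩, ?_⟩
        rcases h4 with ⟨h4, -, rfl⟩ | ⟨-, -, rfl⟩
        · intro h
          rw [show k = m - 1 by omega, hd] at h4
          simp at h4
        · omega
      · simp only [hdm, Bool.false_eq_true, false_and, true_and, false_or] at h4
        exact Or.inr (Or.inr h4)
    · rw [turn_succ_straight hdd] at ht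
      obtain ⟨s', hs', rfl⟩ := (cross_succ_straight hm hdd ht).1 hs
      rcases h with ⟨hdt, h1, h2⟩ | ⟨hdt, h1, h2⟩
      · have h3 := htyp t s' hs' hdt
        rw [if_neg h3] at h1
        refine Or.inl ⟨Or.inr ⟨t, s', ht, hs', Or.inl ⟨hdt, h1, h2⟩⟩, ?_⟩
        rw [h2]; exact hout t ht hdt
      · by_cases h3 : s' = m
        · rw [if_pos h3] at h2
          exact Or.inr (Or.inl ⟨Or.inr ⟨t, s', ht, hs', Or.inr ⟨hdt, h1, h3.symm⟩⟩, h2⟩)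
        · rw [if_neg h3] at h2
          exact Or.inl ⟨Or.inr ⟨t, s', ht, hs', Or.inr ⟨hdt, h1, h2⟩⟩, by rw [h2]; exact h3⟩
  · rintro (⟨⟨k, h1, h2, h3, h4⟩ | ⟨t, s, ht, hs, h⟩, hj⟩ |
      ⟨⟨k, h1, h2, h3, h4⟩ | ⟨t, s, ht, hs, h⟩, hj⟩ | ⟨rfl, rfl⟩)
    · exact Or.inl ⟨k, h1, by omega, fun t ht => h3 t ((turn_succ_straight hdd).1 ht), h4⟩
    · refine Or.inr ⟨t, _, (turn_succ_straight hdd).2 ht,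
        (cross_succ_straight hm hdd ht).2 ⟨s, hs, rfl⟩, ?_⟩
      have : s ≠ m := by
        rcases h with ⟨hdt, -, -⟩ | ⟨-, -, rfl⟩
        · exact htyp t s hs hdt
        · exact hj
      rwa [if_neg this]
    · rcases h4 with ⟨h4, -, hk⟩ | ⟨-, -, hk⟩
      · rw [show k = m - 1 by omega, hd] at h4
        simp at h4
      · omega
    · refine Or.inr ⟨t, _, (turn_succ_straight hdd).2 ht,
        (cross_succ_straight hm hdd ht).2 ⟨s, hs, rfl⟩, ?_⟩
      rcases h with ⟨hdt, -, h⟩ | ⟨hdt, h, h'⟩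
      · exact absurd h.symm (hout t ht hdt)
      · rw [if_pos h'.symm]
        exact Or.inr ⟨hdt, h, hj⟩
    · refine Or.inl ⟨j, by omega, by omega, fun t ht => ?_, Or.inr ⟨hdm, rfl, rfl⟩⟩
      have := ((turn_succ_straight hdd).1 ht).2.1
      have := markedIndex_le g t
      omega

/-- The only old arc into the sink `m` is `m - 1 → m`, which `H` protects from being marked already
at `m - 1`. It is now deleted in favour of `m - 1 → m + 1`, as `m + 1` is the first source below
`m`, and `m + 1 → m` is kept. -/
theorem star_succ_pos (hm : 2 ≤ m) (hd : d (m - 1) = true) (hdm : d m = false) (hg : g m = 1)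
    (H : Turn d m (m - 1) → g (m - 1) = 1) (i j : ℕ) :
    Star d g (m + 1) i j ↔ (Star d g m i j ∧ j ≠ m) ∨ (Star d g m i m ∧ j = m + 1) ∨
      (i = m + 1 ∧ j = m) := by
  have hdd : d (m - 1) ≠ d m := by rw [hd, hdm]; simp
  have hout : ∀ t, Turn d m t → outerEnd g t ≠ m := by
    intro t ht h
    have h' := outerEnd_eq_of_lt ht.2.1 h
    obtain rfl : t = m - 1 := by omega
    exact h'.2 (H ht)
  have htyp : ∀ t s, Cross d g m t s → d t = false → s ≠ m := by
    rintro t s h hdt rfl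
    have := h.typ.2.2.1 hm
    simp [hdt, hd] at this
  have hmark : markedIndex g m = m - 1 := by simp [markedIndex, hg]
  have houtm : outerEnd g m = m - 1 := by simp [outerEnd, hg]
  have hTm : Turn d (m + 1) m := (Turn.succ_iff hm hdd).2 (Or.inr rfl)
  constructor
  · rintro (⟨k, h1, h2, h3, h4⟩ | ⟨t, s, ht, hs, h⟩)
    · rcases Nat.lt_succ_iff_lt_or_eq.1 h2 with hk | rfl
      · have hk' : m - 1 ≠ k := hmark ▸ h3 m hTm
        refine Or.inl ⟨Or.inl ⟨k, h1, hk, fun t ht => h3 t ((Turn.succ_iff hm hdd).2 (Or.inl ht)),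
          h4⟩, ?_⟩
        rcases h4 with ⟨h4, -, rfl⟩ | ⟨-, -, rfl⟩ <;> omega
      · simp only [hdm, Bool.false_eq_true, false_and, true_and, false_or] at h4
        exact Or.inr (Or.inr h4)
    · rcases (Turn.succ_iff hm hdd).1 ht with ht | rfl
      · rw [cross_succ_turn hm hdd ht] at hs
        refine Or.inl ⟨Or.inr ⟨t, s, ht, hs, h⟩, ?_⟩
        rcases h with ⟨hdt, h1, rfl⟩ | ⟨hdt, h1, rfl⟩
        · exact hout t ht
        · exact htyp t j hs hdt
      · rcases hs with ⟨-, hs⟩ | ⟨hg', -⟩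
        · have h5 := hs.1.2
          have h6 := hs.1.1.2.1
          simp only [hdm, Bool.false_eq_true, false_and, true_and, false_or, houtm] at h
          refine Or.inr (Or.inl ⟨Or.inl ⟨t - 1, by omega, by omega, fun t' ht' hmk => ?_,
            Or.inl ⟨hd, h.1, by omega⟩⟩, by omega⟩)
          have h7 := ht'.2.1
          -- Only the turning point just above, with negative signature, could have marked this arc.
          unfold markedIndex at hmk
          split_ifs at hmk with h8
          · omega
          · subst hmk; exact h8 (H ht')
        · rw [hg] at hg'; exact absurd hg' (by decide)
  · rintro (⟨⟨k, h1, h2, h3, h4⟩ | ⟨t, s, ht, hs, h⟩, hj⟩ |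
      ⟨⟨k, h1, h2, h3, h4⟩ | ⟨t, s, ht, hs, h⟩, hj⟩ | ⟨rfl, rfl⟩)
    · refine Or.inl ⟨k, h1, by omega, fun t ht => ?_, h4⟩
      rcases (Turn.succ_iff hm hdd).1 ht with ht | rfl
      · exact h3 t ht
      · rw [hmark]
        rintro rfl
        simp only [hd, Bool.true_eq_false, false_and, or_false, true_and] at h4
        omega
    · exact Or.inr ⟨t, s, (Turn.succ_iff hm hdd).2 (Or.inl ht), (cross_succ_turn hm hdd ht).2 hs, h⟩
    · rcases h4 with ⟨h4, hi, hk⟩ | ⟨-, -, hk⟩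
      · refine Or.inr ⟨m, m + 1, hTm, Or.inl ⟨hg, ⟨(typ_succ_turn hm hdd).2 (Or.inr ⟨rfl, rfl⟩),
          by omega⟩, fun v hv => hv.2⟩, Or.inr ⟨hdm, by rw [houtm]; omega, hj⟩⟩
      · omega
    · rcases h with ⟨hdt, h1, h2⟩ | ⟨hdt, h1, h2⟩
      · exact absurd h2.symm (hout t ht)
      · exact absurd h2.symm (htyp t s hs hdt)
    · refine Or.inl ⟨j, by omega, by omega, fun t ht => ?_, Or.inr ⟨hdm, rfl, rfl⟩⟩
      rcases (Turn.succ_iff hm hdd).1 ht with ht | rfl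
      · have := ht.2.1
        have := markedIndex_le g t
        omega
      · omega

/-- The deleted arc is the new one, so all old arcs survive. The point crossed is the first source
after the last negative sink above `m`, which is the start `s` of the old path. -/
theorem star_succ_neg {s : ℕ} (hm : 2 ≤ m) (hd : d (m - 1) = true) (hdm : d m = false)
    (hg : g m = -1) (hs : Extremal d g m true s) (i j : ℕ) :
    Star d g (m + 1) i j ↔ Star d g m i j ∨ (i = m + 1 ∧ j = s) := by
  have hdd : d (m - 1) ≠ d m := by rw [hd, hdm]; simp
  have hg1 : g m ≠ 1 := by rw [hg]; decide
  have hmark : markedIndex g m = m := by simp [markedIndex, hg1]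
  have houtm : outerEnd g m = m + 1 := by simp [outerEnd, hg1]
  have hTm : Turn d (m + 1) m := (Turn.succ_iff hm hdd).2 (Or.inr rfl)
  constructor
  · rintro (⟨k, h1, h2, h3, h4⟩ | ⟨t, s', ht, hs', h⟩)
    · rcases Nat.lt_succ_iff_lt_or_eq.1 h2 with hk | rfl
      · exact Or.inl (Or.inl ⟨k, h1, hk, fun t ht => h3 t ((Turn.succ_iff hm hdd).2 (Or.inl ht)),
          h4⟩)
      · exact absurd hmark (h3 k hTm)
    · rcases (Turn.succ_iff hm hdd).1 ht with ht | rfl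
      · rw [cross_succ_turn hm hdd ht] at hs'
        exact Or.inl (Or.inr ⟨t, s', ht, hs', h⟩)
      · rcases hs' with ⟨hg', -⟩ | ⟨-, r, hr, hs'⟩
        · exact absurd hg' hg1
        · rw [first_succ_turn hm hdd (hr.exists_first hm le_rfl).2] at hs'
          simp only [hdm, Bool.false_eq_true, false_and, true_and, false_or, houtm] at h hr hs'
          obtain rfl := hs.unique ⟨r, hr, hs'⟩
          exact Or.inr h
  · rintro ((⟨k, h1, h2, h3, h4⟩ | ⟨t, s, ht, hs, h⟩) | ⟨hi, hj⟩)
    · refine Or.inl ⟨k, h1, by omega, fun t ht => ?_, h4⟩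
      rcases (Turn.succ_iff hm hdd).1 ht with ht | rfl
      · exact h3 t ht
      · omega
    · exact Or.inr ⟨t, s, (Turn.succ_iff hm hdd).2 (Or.inl ht), (cross_succ_turn hm hdd ht).2 hs, h⟩
    · obtain ⟨r, hr, hs⟩ := hs
      refine Or.inr ⟨m, s, hTm, Or.inr ⟨hg, r, by simpa [hdm] using hr, ?_⟩,
        Or.inr ⟨hdm, by rw [houtm, hi], hj⟩⟩
      rw [hdm, Bool.not_false, first_succ_turn hm hdd ⟨s, hs⟩]
      exact hs

/-! ### Evolution of the two ends, and the induction -/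

theorem LastNeg.succ {c : Bool} {r : ℕ} (h : LastNeg d g c m r) (hm : ¬ Neg d g c m) :
    LastNeg d g c (m + 1) r := by
  have : {r | Neg d g c r ∧ r < m + 1} = {r | Neg d g c r ∧ r < m} := by
    ext r
    simp only [Set.mem_ofPred_eq, Nat.lt_succ_iff_lt_or_eq]
    constructor
    · rintro ⟨h1, h2 | rfl⟩
      · exact ⟨h1, h2⟩
      · exact absurd h1 hm
    · rintro ⟨h1, h2⟩
      exact ⟨h1, Or.inl h2⟩
  unfold LastNeg
  rw [this]
  exact h

theorem Extremal.succ_straight {c : Bool} {s : ℕ} (hm : 2 ≤ m) (hd : d (m - 1) = d m)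
    (h : Extremal d g m c s) : Extremal d g (m + 1) c (if s = m then m + 1 else s) := by
  obtain ⟨r, hr, h⟩ := h
  exact ⟨r, hr.succ fun hn => hn.2.1 hd, h.succ_straight hm hd⟩

theorem Extremal.succ_turn {c : Bool} {s : ℕ} (hm : 2 ≤ m) (hd : d (m - 1) ≠ d m)
    (h : Extremal d g m c s) (hn : ¬ Neg d g (!c) m) : Extremal d g (m + 1) c s := by
  obtain ⟨r, hr, h⟩ := h
  exact ⟨r, hr.succ hn, (first_succ_turn hm hd ⟨s, h⟩).2 h⟩

theorem Extremal.succ_neg {c : Bool} (hm : 2 ≤ m) (hd : d (m - 1) ≠ d m) (hdm : d m = !c)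
    (hg : g m = -1) : Extremal d g (m + 1) c (m + 1) := by
  refine ⟨m, Or.inl ⟨⟨⟨hm, hd, hdm, hg⟩, Nat.lt_succ_self m⟩, fun r hr => Nat.lt_succ_iff.1 hr.2⟩,
    ⟨(typ_succ_turn hm hd).2 (Or.inr ⟨rfl, by simp [hdm]⟩), Nat.lt_succ_self m⟩, fun v hv => hv.2⟩

/-- The straightening of the path `1, …, m` is a single path, with the expected ends. -/
def StarIsPath (d : ℕ → Bool) (g : ℕ → ℤˣ) (m : ℕ) : Prop :=
  ∃ s f, Extremal d g m true s ∧ Extremal d g m false f ∧ IsPathRel m (Star d g m) s f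

theorem starIsPath_not : StarIsPath (fun i => !d i) g m ↔ StarIsPath d g m := by
  unfold StarIsPath
  simp only [extremal_not, Bool.not_true, Bool.not_false]
  constructor
  · rintro ⟨s, f, h1, h2, h3⟩
    exact ⟨f, s, h2, h1, h3.flip fun i j => (star_not d g m j i).symm⟩
  · rintro ⟨s, f, h1, h2, h3⟩
    exact ⟨f, s, h2, h1, h3.flip fun i j => star_not d g m i j⟩

theorem StarIsPath.succ_of_false (hm : 2 ≤ m) (hdm : d m = false)
    (H : Turn d m (m - 1) → Turn d (m + 1) m → g (m - 1) = -1 → g m ≠ 1)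
    (h : StarIsPath d g m) : StarIsPath d g (m + 1) := by
  obtain ⟨s, f, hs, hf, hp⟩ := h
  cases hd : d (m - 1)
  · have hdd : d (m - 1) = d m := by rw [hd, hdm]
    refine ⟨_, f, hs.succ_straight hm hdd, ?_,
      hp.insert ⟨by omega, le_rfl⟩ (star_succ_straight hm hd hdm)⟩
    -- The finish is a sink whereas the end `m` is here a source, so the finish does not move.
    have := hf.succ_straight hm hdd
    rwa [if_neg] at this
    rintro rfl
    obtain ⟨r, -, hr⟩ := hf
    have := (typ_last hm hdd).1 hr.1.1
    simp [hdm] at this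
  · have hdd : d (m - 1) ≠ d m := by rw [hd, hdm]; simp
    have hf' : Extremal d g (m + 1) false f := hf.succ_turn hm hdd fun hn => by
      have := hn.2.2.1
      simp [hdm] at this
    have hT : Turn d (m + 1) m := ⟨hm, by omega, hdd⟩
    rcases Int.units_eq_one_or (g m) with hg | hg
    · have H' : Turn d m (m - 1) → g (m - 1) = 1 := fun ht => by
        rcases Int.units_eq_one_or (g (m - 1)) with h | h
        · exact h
        · exact absurd hg (H ht hT h)
      have hp' := hp.insert ⟨by omega, le_rfl⟩ (star_succ_pos hm hd hdm hg H')
      rw [if_neg] at hp'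
      · refine ⟨s, f, hs.succ_turn hm hdd fun hn => ?_, hf', hp'⟩
        have := hn.2.2.2
        rw [hg] at this
        exact absurd this (by decide)
      · rintro rfl
        obtain ⟨r, -, hr⟩ := hs
        have := hr.1.1.2.2.1 hm
        simp [hd] at this
    · exact ⟨m + 1, f, Extremal.succ_neg hm hdd hdm hg, hf',
        hp.prepend (star_succ_neg hm hd hdm hg hs)⟩

theorem StarIsPath.succ (hm : 2 ≤ m)
    (H : Turn d m (m - 1) → Turn d (m + 1) m → g (m - 1) = -1 → g m ≠ 1)
    (h : StarIsPath d g m) : StarIsPath d g (m + 1) := by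
  cases hdm : d m
  · exact h.succ_of_false hm hdm H
  · rw [← starIsPath_not] at h ⊢
    refine h.succ_of_false hm (by simp [hdm]) ?_
    rwa [turn_not, turn_not]

theorem starIsPath_two_of_false (hd : d 1 = false) : StarIsPath d g 2 := by
  have hT : ∀ t, ¬ Turn d 2 t := fun t ht => by have := ht.1; have := ht.2.1; omega
  have hL : ∀ c, LastNeg d g c 2 0 := fun c => Or.inr ⟨by
    ext r
    simp only [Set.mem_ofPred_eq, Set.mem_empty_iff_false, iff_false, not_and]
    intro hr
    have := hr.1
    omega, rfl⟩
  refine ⟨2, 1, ⟨0, hL _, ⟨⟨by omega, le_rfl, fun _ => by simpa using hd, by omega⟩, by omega⟩,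
    fun v hv => ?_⟩, ⟨0, hL _, ⟨⟨by omega, by omega, by omega, fun _ => hd⟩, by omega⟩,
    fun v hv => hv.2⟩, [2, 1], by simp, fun x => ?_, fun i j => ?_, rfl, rfl⟩
  · have h1 := hv.2
    have h2 := hv.1.2.2.2
    by_contra hlt
    obtain rfl : v = 1 := by omega
    simpa [hd] using h2 (by omega)
  · simp; omega
  · simp only [Consec, or_false]
    constructor
    · rintro (⟨k, h1, h2, h3, h4⟩ | ⟨t, s, ht, -⟩)
      · obtain rfl : k = 1 := by omega
        simpa [hd] using h4
      · exact absurd ht (hT t)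
    · rintro ⟨rfl, rfl⟩
      exact Or.inl ⟨1, le_rfl, by omega, fun t ht => absurd ht (hT t), Or.inr ⟨hd, rfl, rfl⟩⟩

/-- If no arc is marked twice then the straightening of the path `1, …, m` is a single path. -/
theorem starIsPath (hm : 2 ≤ m)
    (H : ∀ t, Turn d m t → Turn d m (t + 1) → g t = -1 → g (t + 1) ≠ 1) : StarIsPath d g m := by
  induction m, hm using Nat.le_induction with
  | base =>
    cases hd : d 1
    · exact starIsPath_two_of_false hd
    · rw [← starIsPath_not]
      exact starIsPath_two_of_false (by simp [hd])
  | succ m hm ih =>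
    refine (ih fun t h1 h2 => H t ⟨h1.1, Nat.lt_succ_of_lt h1.2.1, h1.2.2⟩
      ⟨h2.1, Nat.lt_succ_of_lt h2.2.1, h2.2.2⟩).succ hm fun h1 h2 => ?_
    have := H (m - 1) ⟨h1.1, Nat.lt_succ_of_lt h1.2.1, h1.2.2⟩
    rw [Nat.sub_add_cancel (by omega)] at this
    exact this h2

/-! ### Location of the ends among the turning points -/

theorem Typ.turn {c : Bool} {t : ℕ} (h : Typ d m c t) (h2 : 2 ≤ t) (hm : t < m) : Turn d m t :=
  ⟨h2, hm, by rw [h.2.2.1 h2, h.2.2.2 hm]; cases c <;> simp⟩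

/-- A discrete intermediate value argument: the orientation changes from `!c` to `c` somewhere, and
it has done so before the last arc. This yields the alternation of sources and sinks. -/
theorem exists_typ_between {c : Bool} {r t : ℕ} (hr : 1 ≤ r) (hrt : r < t) (htm : t ≤ m)
    (hdr : d r = !c) (hdt : d (t - 1) = c) : ∃ u, r < u ∧ u < t ∧ Typ d m c u := by
  obtain ⟨u, ⟨⟨h1, h2, h3, h4⟩, h5⟩, -⟩ := exists_first hr hrt hdr
  have h5' : r < u := h5
  have hne : u ≠ t := by
    rintro rfl
    rw [h3 (by omega)] at hdt
    revert hdt; cases c <;> simp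
  exact ⟨u, h5, by omega, h1, by omega, h3, fun _ => h4 (by omega)⟩

theorem turn_eq {t : ℕ} {c : Bool} (h : Turn d m t) (hc : d t = c) : d (t - 1) = !c := by
  have := h.2.2
  rw [hc] at this
  revert this; cases d (t - 1) <;> cases c <;> simp

theorem Turn.typ {t : ℕ} {c : Bool} (h : Turn d m t) (hc : d t = c) : Typ d m c t :=
  ⟨by have := h.1; omega, h.2.1.le, fun _ => turn_eq h hc, fun _ => hc⟩

/-- The first turning point of type `c` after a turning point of the opposite type is the
next turning point. -/
theorem First.isLeast_turning {c : Bool} {r s : ℕ} (hr : Turn d m r) (hdr : d r = !c)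
    (h : First d m c r s) : IsLeast {u | (u = 1 ∨ u = m ∨ Turn d m u) ∧ r < u} s := by
  have hr1 := hr.1
  have hrs : r < s := h.1.2
  have hsm := h.1.1.2.1
  refine ⟨⟨?_, hrs⟩, ?_⟩
  · by_cases hs : s = m
    · exact Or.inr (Or.inl hs)
    · exact Or.inr (Or.inr (h.1.1.turn (by omega) (by omega)))
  · rintro u ⟨hu, hru⟩
    by_contra hlt
    rcases hu with rfl | rfl | hu
    · omega
    · omega
    · by_cases hdu : d u = c
      · exact hlt (h.2 ⟨hu.typ hdu, hru⟩)
      · have hdu' : d u = !c := by revert hdu; cases d u <;> cases c <;> simp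
        have := turn_eq hu hdu'
        rw [Bool.not_not] at this
        obtain ⟨v, hv1, hv2, hv3⟩ := exists_typ_between (by omega) hru hu.2.1.le hdr this
        have : s ≤ v := h.2 ⟨hv3, hv1⟩
        omega

theorem Extremal.eq_one_iff {c : Bool} {s : ℕ} (h : Extremal d g m c s) :
    s = 1 ↔ Typ d m c 1 ∧ ∀ t, t < m → ¬ Neg d g (!c) t := by
  obtain ⟨r, hr, h⟩ := h
  constructor
  · rintro rfl
    refine ⟨h.1.1, fun t htm ht => ?_⟩
    have h1 : r < 1 := h.1.2
    rcases hr with hr | ⟨hr, -⟩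
    · have := hr.1.1.1
      omega
    · have : t ∈ {r | Neg d g (!c) r ∧ r < m} := ⟨ht, htm⟩
      rw [hr] at this
      exact this
  · rintro ⟨h1, h2⟩
    rcases hr with hr | ⟨-, rfl⟩
    · exact absurd hr.1.1 (h2 r hr.1.2)
    · have : s ≤ 1 := h.2 ⟨h1, by omega⟩
      have := h.1.1.1
      omega

/-- If no point of type `c` lies strictly between `r` and `m`, alternation shows that `r` is the
last internal turning point of type `!c`, or, when `r = 0`, that there is no internal turning point.
Conversely, if `s < m` have the same type, a point of type `!c` lies between them; the last such
point is negative, so `r` would lie beyond `s`. -/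
theorem Extremal.eq_last_iff {c : Bool} {s : ℕ} (hm : 2 ≤ m) (h : Extremal d g m c s) :
    s = m ↔ Typ d m c m ∧ ((∃ t, Turn d m t) →
      ∃ p, IsGreatest {t | Turn d m t ∧ d t = !c} p ∧ g p = -1) := by
  obtain ⟨r, hr, h⟩ := h
  constructor
  · rintro rfl
    refine ⟨h.1.1, fun ⟨t, ht⟩ => ?_⟩
    have hno : ∀ v, r < v → v < s → ¬ Typ d s c v := fun v h1 h2 h3 => by
      have : s ≤ v := h.2 ⟨h3, h1⟩
      omega
    rcases hr with hr | ⟨-, rfl⟩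
    · obtain ⟨⟨⟨h1, h2, h3, h4⟩, h5⟩, -⟩ := hr
      refine ⟨r, ⟨⟨⟨h1, h5, h2⟩, h3⟩, ?_⟩, h4⟩
      rintro u ⟨hu, hdu⟩
      by_contra hlt
      have := turn_eq hu hdu
      rw [Bool.not_not] at this
      obtain ⟨v, hv1, hv2, hv3⟩ :=
        exists_typ_between (by omega) (by omega : r < u) hu.2.1.le h3 this
      exact hno v hv1 (hv2.trans hu.2.1) hv3
    · exfalso
      have ht2 := ht.1
      have hd1 : d 1 = !c := by
        have : d 1 ≠ c := fun h1 => hno 1 (by omega) (by omega)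
          ⟨le_rfl, by omega, by omega, fun _ => h1⟩
        revert this; cases d 1 <;> cases c <;> simp
      have hdt : d t = !c := by
        have : d t ≠ c := fun h1 => hno t (by omega) ht.2.1 (ht.typ h1)
        revert this; cases d t <;> cases c <;> simp
      have := turn_eq ht hdt
      rw [Bool.not_not] at this
      obtain ⟨v, hv1, hv2, hv3⟩ :=
        exists_typ_between le_rfl (by omega : 1 < t) ht.2.1.le hd1 this
      exact hno v (by omega) (hv2.trans ht.2.1) hv3
  · rintro ⟨h1, h2⟩
    by_contra hne
    have hs := h.1.1
    have hsm : s < m := lt_of_le_of_ne hs.2.1 hne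
    obtain ⟨v, hv1, hv2, hv3⟩ := exists_typ_between (c := !c) hs.1 hsm le_rfl
      (by rw [hs.2.2.2 hsm, Bool.not_not]) (h1.2.2.1 hm)
    have hs1 := hs.1
    have hv := hv3.turn (by omega) hv2
    obtain ⟨p, hp, hgp⟩ := h2 ⟨v, hv⟩
    have hvp : v ≤ p := hp.2 ⟨hv, hv3.2.2.2 hv2⟩
    have hpn : p ∈ {r | Neg d g (!c) r ∧ r < m} :=
      ⟨⟨hp.1.1.1, hp.1.1.2.2, hp.1.2, hgp⟩, hp.1.1.2.1⟩
    rcases hr with hr | ⟨hr, -⟩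
    · have : p ≤ r := hr.2 hpn
      have : r < s := h.1.2
      omega
    · rw [hr] at hpn
      exact hpn

end straighten

/-! ### Walks along an orbit of two involutions -/

section walk

variable {σ : Bool → Equiv.Perm ℤ} {x : ℕ → ℤ} {w : ℕ → Bool}

/-- If `x i = x j` and the outgoing signs differ, the step out of `i` undoes the step into `j`, so
`x (i + 1) = x (j - 1)`. The coincidence folds inwards until two adjacent points agree. -/
theorem walk_ne_of_ne (hσ : ∀ c y, σ c (σ c y) = y) (hx : ∀ k, x (k + 1) = σ (w k) (x k))
    (hw : ∀ k, w (k + 1) = !w k) {N : ℕ} (hN : ∀ k < N, x (k + 1) ≠ x k) (l i : ℕ)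
    (hl : i + l + 1 ≤ N) (hne : w i ≠ w (i + l + 1)) : x i ≠ x (i + l + 1) := by
  induction l using Nat.twoStepInduction generalizing i with
  | zero => exact fun h => hN i (by omega) h.symm
  | one =>
    rw [hw, hw] at hne
    simp at hne
  | more l ih _ =>
    intro h
    have h1 : x (i + 1) = x (i + 1 + l + 1) := by
      rw [hx i, h, show i + (l + 2) + 1 = (i + 1 + l + 1) + 1 by omega, hx (i + 1 + l + 1)]
      have : w (i + 1 + l + 1) = w i := by
        rw [show i + (l + 2) + 1 = (i + 1 + l + 1) + 1 by omega, hw] at hne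
        revert hne; cases w i <;> cases w (i + 1 + l + 1) <;> simp
      rw [this, hσ]
    refine ih (i + 1) (by omega) ?_ h1
    rw [show i + (l + 2) + 1 = (i + 1 + l + 1) + 1 by omega, hw] at hne
    rw [hw i]
    revert hne; cases w i <;> cases w (i + 1 + l + 1) <;> simp

/-- With equal outgoing signs a coincidence can be pulled back to `i = 0`. There the fixed starting
point forces the step into its repetition to be stationary. -/
theorem walk_ne_of_eq (hσ : ∀ c y, σ c (σ c y) = y) (hx : ∀ k, x (k + 1) = σ (w k) (x k))
    (hw : ∀ k, w (k + 1) = !w k) (h0 : σ (!w 0) (x 0) = x 0) {N : ℕ}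
    (hN : ∀ k < N, x (k + 1) ≠ x k) (i l : ℕ)
    (hl : i + l + 1 ≤ N) (he : w i = w (i + l + 1)) : x i ≠ x (i + l + 1) := by
  induction i with
  | zero =>
    intro h
    rw [Nat.zero_add] at h he hl
    apply hN l (by omega)
    rw [hw] at he
    rw [he, Bool.not_not, h, hx, hσ] at h0
    rw [hx]; exact h0.symm
  | succ i ih =>
    intro h
    have hw' : w i = w (i + l + 1) := by
      rw [show i + 1 + l + 1 = i + l + 1 + 1 by omega, hw, hw] at he
      simpa using he
    refine ih (by omega) hw' ?_
    rw [show i + 1 + l + 1 = i + l + 1 + 1 by omega, hx, hx (i + l + 1), hw'] at h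
    exact (σ _).injective h

theorem walk_injOn (hσ : ∀ c y, σ c (σ c y) = y) (hx : ∀ k, x (k + 1) = σ (w k) (x k))
    (hw : ∀ k, w (k + 1) = !w k) (h0 : σ (!w 0) (x 0) = x 0) {N : ℕ}
    (hN : ∀ k < N, x (k + 1) ≠ x k) : Set.InjOn x (Set.Iic N) := by
  have key : ∀ i j, i < j → j ≤ N → x i ≠ x j := by
    intro i j hij hj
    obtain ⟨l, rfl⟩ := Nat.exists_eq_add_of_lt hij
    by_cases h : w i = w (i + l + 1)
    · exact walk_ne_of_eq hσ hx hw h0 hN i l hj h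
    · exact walk_ne_of_ne hσ hx hw hN l i hj h
  intro i hi j hj h
  rcases lt_trichotomy i j with hij | hij | hij
  · exact absurd h (key i j hij hj)
  · exact hij
  · exact absurd h.symm (key j i hij hi)

theorem orbit_subset {σ τ : Equiv.Perm ℤ} {S : Set ℤ} {a : ℤ}
    (ha : a ∈ S) (hσ : ∀ y, σ y ∈ S ↔ y ∈ S) (hτ : ∀ y, τ y ∈ S ↔ y ∈ S) :
    MulAction.orbit (Subgroup.closure {σ, τ}) a ⊆ S := by
  rintro _ ⟨⟨p, hp⟩, rfl⟩
  have : ∀ y, p y ∈ S ↔ y ∈ S := by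
    induction hp using Subgroup.closure_induction with
    | mem p hp =>
      rcases hp with rfl | rfl
      · exact hσ
      · exact hτ
    | one => simp
    | mul p q _ _ h1 h2 => intro y; rw [Equiv.Perm.mul_apply, h1, h2]
    | inv p _ h => intro y; rw [← h (p⁻¹ y)]; simp
  exact (this a).2 ha

theorem IsMeander.mem_iff {σ τ : Equiv.Perm ℤ} {X : Set ℤ} (h : IsMeander σ τ X) (y : ℤ) :
    (σ y ∈ X ↔ y ∈ X) ∧ (τ y ∈ X ↔ y ∈ X) := by
  obtain ⟨x, rfl⟩ := h
  have key : ∀ p ∈ Subgroup.closure {σ, τ}, (p y ∈ MulAction.orbit (Subgroup.closure {σ, τ}) x ↔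
      y ∈ MulAction.orbit (Subgroup.closure {σ, τ}) x) := by
    intro p hp
    rw [← MulAction.orbit_eq_iff, ← MulAction.orbit_eq_iff (a := y), ←
      MulAction.orbit_smul (⟨p, hp⟩ : Subgroup.closure {σ, τ}) y]
    rfl
  exact ⟨key _ (Subgroup.subset_closure (by simp)), key _ (Subgroup.subset_closure (by simp))⟩

/-- A walk that never stalls is injective, which finiteness forbids. At the first stall the set of
visited points is stable under both involutions, hence is the whole orbit. -/
theorem walk_bijOn (hσ : ∀ c y, σ c (σ c y) = y) (hx : ∀ k, x (k + 1) = σ (w k) (x k))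
    (hw : ∀ k, w (k + 1) = !w k) (h0 : σ (!w 0) (x 0) = x 0) {X : Set ℤ}
    (hX : IsMeander (σ true) (σ false) X) (hfin : X.Finite) (hmem : x 0 ∈ X) :
    ∃ N, X.ncard = N + 1 ∧ Set.BijOn x (Set.Iic N) X ∧ x (N + 1) = x N := by
  classical
  have hcl : ∀ c y, σ c y ∈ X ↔ y ∈ X := by
    intro c y
    cases c
    · exact (hX.mem_iff y).2
    · exact (hX.mem_iff y).1
  have hxX : ∀ k, x k ∈ X := by
    intro k
    induction k with
    | zero => exact hmem
    | succ k ih => rw [hx, hcl]; exact ih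
  have hst : ∃ N, x (N + 1) = x N := by
    by_contra hno
    push Not at hno
    have hinj : Function.Injective x := by
      intro i j h
      exact walk_injOn hσ hx hw h0 (N := max i j) (fun k _ => hno k) (by simp) (by simp) h
    exact Set.infinite_range_of_injective hinj
      (hfin.subset (by rintro _ ⟨k, rfl⟩; exact hxX k))
  have hN := Nat.find_spec hst
  have hmin : ∀ k < Nat.find hst, x (k + 1) ≠ x k := fun k hk => Nat.find_min hst hk
  set N := Nat.find hst
  have hinj := walk_injOn hσ hx hw h0 hmin
  have hS : ∀ c, ∀ y ∈ x '' Set.Iic N, σ c y ∈ x '' Set.Iic N := by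
    rintro c _ ⟨k, hk, rfl⟩
    have hk' : k ≤ N := hk
    by_cases hc : c = w k
    · rw [hc, ← hx]
      rcases hk'.eq_or_lt with hkN | hk'
      · rw [hkN, hN]; exact ⟨N, Set.self_mem_Iic, rfl⟩
      · exact ⟨k + 1, hk', rfl⟩
    · have hc' : c = !w k := by revert hc; cases c <;> cases w k <;> simp
      cases k with
      | zero => rw [hc', h0]; exact ⟨0, hk, rfl⟩
      | succ k =>
        rw [hw, Bool.not_not] at hc'
        rw [hc', hx, hσ]
        exact ⟨k, by simp only [Set.mem_Iic]; omega, rfl⟩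
  have hS' : ∀ c y, σ c y ∈ x '' Set.Iic N ↔ y ∈ x '' Set.Iic N := by
    intro c y
    refine ⟨fun h => ?_, hS c y⟩
    have := hS c _ h
    rwa [hσ] at this
  have hXS : X = x '' Set.Iic N := by
    apply Set.Subset.antisymm
    · obtain ⟨z, rfl⟩ := hX
      rw [← MulAction.orbit_eq_iff.2 hmem]
      exact orbit_subset ⟨0, by simp, rfl⟩ (hS' true) (hS' false)
    · rintro _ ⟨k, -, rfl⟩
      exact hxX k
  refine ⟨N, ?_, ?_, hN⟩
  · rw [hXS, hinj.ncard_image, ← Finset.coe_Iic, Set.ncard_coe_finset, Nat.card_Iic]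
  · rw [hXS]
    exact hinj.bijOn_image

end walk

/-- The edge `E` of the involutions `σ true, σ false`, with the sequence `f` of its `m` points and
the signs `w` of its arcs. -/
structure IsWalk (σ : Bool → Equiv.Perm ℤ) (E : Set ℤ) (m : ℕ) (f : ℕ → ℤ) (w : ℕ → Bool) :
    Prop where
  invol : ∀ c y, σ c (σ c y) = y
  sign_succ : ∀ t, 1 ≤ t → w (t + 1) = !w t
  succ : ∀ t, 1 ≤ t → f (t + 1) = σ (w t) (f t)
  first : σ (!w 1) (f 1) = f 1
  last : σ (w m) (f m) = f m
  bijOn : Set.BijOn f (Set.Icc 1 m) E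
  closed : ∀ c y, σ c y ∈ E ↔ y ∈ E
  two_le : 2 ≤ m

theorem exists_isWalk {σ : Bool → Equiv.Perm ℤ} (hσ : ∀ c y, σ c (σ c y) = y) {E : Set ℤ}
    (hE : IsMeander (σ true) (σ false) E) (hE1 : 1 < E.ncard) {a : ℤ} (ha : a ∈ E)
    (ha' : σ true a = a ∨ σ false a = a) :
    ∃ w, IsWalk σ E E.ncard (phi σ a) w ∧ phi σ a 1 = a := by
  obtain ⟨b, hb, hphi⟩ : ∃ b, σ b a = a ∧ ∀ t, phi σ a t = altWord (σ !b) (σ b) (t - 1) a := by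
    by_cases h : σ true a = a
    · exact ⟨true, h, fun t => by simp [phi, h]⟩
    · exact ⟨false, ha'.resolve_left h, fun t => by simp [phi, h]⟩
  set v : ℕ → Bool := fun k => if Even k then !b else b with hv
  set x : ℕ → ℤ := fun k => altWord (σ !b) (σ b) k a with hxd
  have hw : ∀ k, v (k + 1) = !v k := by
    intro k
    simp only [hv, Nat.even_add_one]
    split_ifs <;> simp
  have hx : ∀ k, x (k + 1) = σ (v k) (x k) := by
    intro k
    simp only [hxd, altWord, Equiv.Perm.mul_apply, hv]
    split_ifs <;> rfl
  have hx0 : x 0 = a := by simp [hxd, altWord]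
  have h0 : σ (!v 0) (x 0) = x 0 := by simp [hv, hx0, hb]
  have hfin : E.Finite := Set.finite_of_ncard_pos (by omega)
  obtain ⟨N, hN, hbij, hlast⟩ := walk_bijOn hσ hx hw h0 hE hfin (by rw [hx0]; exact ha)
  have hphix : ∀ t, phi σ a t = x (t - 1) := hphi
  refine ⟨fun t => v (t - 1), ⟨hσ, ?_, ?_, ?_, ?_, ?_, ?_, hE1⟩, ?_⟩
  · intro t ht
    obtain ⟨k, rfl⟩ := Nat.exists_eq_add_of_le' ht
    simpa using hw k
  · intro t ht
    obtain ⟨k, rfl⟩ := Nat.exists_eq_add_of_le' ht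
    simpa [hphix] using hx k
  · simpa [hphix] using h0
  · rw [hN, hphix, Nat.add_sub_cancel, ← hx, hlast]
  · have h1 : Set.BijOn (fun t : ℕ => t - 1) (Set.Icc 1 E.ncard) (Set.Iic N) := by
      refine ⟨fun t ht => ?_, fun t ht u hu h => ?_, fun k hk => ⟨k + 1, ?_, by simp⟩⟩
      · have := ht.2
        simp only [Set.mem_Iic]; omega
      · have := ht.1
        have := hu.1
        simp only at h; omega
      · simp only [Set.mem_Iic, Set.mem_Icc] at hk ⊢; omega
    exact (hbij.comp h1).congr fun t _ => (hphix t).symm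
  · intro c y
    cases c
    · exact (hE.mem_iff y).2
    · exact (hE.mem_iff y).1
  · simpa [hphix] using hx0

/-! ### Position of the points moved by a modified involution -/

/-- Equality occurs when `|J|` is odd and `s` is the centre of `J`, which belongs to both halves. -/
theorem leftHalf_bounds {lo hi r s y : ℤ} {M : Set ℤ} (hM : IsMarkedInterval lo hi M r s)
    (hy : y ∈ leftHalf lo hi r s) : lo ≤ y ∧ 2 * y ≤ lo + hi := by
  obtain ⟨h1, h2, h3, -⟩ := hM
  unfold leftHalf at hy
  unfold lastArc at *
  split_ifs at hy with h
  · have := hy.1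
    have := hy.2
    omega
  · have := hy.1
    have := hy.2
    rw [Int.even_iff] at h
    omega

theorem image_leftHalf_bounds {lo hi r s y : ℤ} {M : Set ℤ} (hM : IsMarkedInterval lo hi M r s)
    (hy : y ∈ kappa lo hi '' leftHalf lo hi r s) : lo + hi ≤ 2 * y := by
  obtain ⟨z, hz, rfl⟩ := hy
  have h1 := leftHalf_bounds hM hz
  have : kappa lo hi z = lo + hi - z ∨ kappa lo hi z = z ∧ ¬ (lo ≤ z ∧ z ≤ hi) := by
    change (if lo ≤ z ∧ z ≤ hi then lo + hi - z else z) = _ ∨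
      (if lo ≤ z ∧ z ≤ hi then lo + hi - z else z) = _ ∧ _
    split_ifs with h
    · exact Or.inl rfl
    · exact Or.inr ⟨rfl, h⟩
  have h2 : r ≤ z := by
    unfold leftHalf at hz
    split_ifs at hz <;> exact hz.1
  obtain ⟨h3, h4, h5, -⟩ := hM
  unfold lastArc at h5
  omega

/-- On an extended component this is the property that arcs join the two halves; elsewhere `σ` is
the reflection of `J`. -/
theorem IsAntiToeplitz.bounds {lo hi : ℤ} {M : Set ℤ} {σ : Equiv.Perm ℤ}
    (h : IsAntiToeplitz lo hi M σ) {x : ℤ} (hx1 : lo ≤ x) (hx2 : x ≤ hi) :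
    (x < σ x → 2 * x ≤ lo + hi) ∧ (σ x < x → lo + hi ≤ 2 * x) := by
  by_cases hx : ∃ r s, IsMarkedInterval lo hi M r s ∧ x ∈ extended lo hi r s
  · obtain ⟨r, s, hrs, hx⟩ := hx
    by_cases hfix : σ x = x
    · rw [hfix]; simp
    · rcases (h.1 r s hrs).2.2 x hx hfix with ⟨h1, h2⟩ | ⟨h1, h2⟩
      · have := leftHalf_bounds hrs h1
        have := image_leftHalf_bounds hrs h2
        omega
      · have := leftHalf_bounds hrs h1
        have := image_leftHalf_bounds hrs h2
        omega
  · have hκ := h.2 x hx1 hx2 fun r s hrs hxe => hx ⟨r, s, hrs, hxe⟩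
    have : kappa lo hi x = lo + hi - x := by
      change (if lo ≤ x ∧ x ≤ hi then lo + hi - x else x) = _
      rw [if_pos ⟨hx1, hx2⟩]
    omega

theorem DoublePartition.exists_component {n : ℕ} (P : DoublePartition n) (s : Bool) {x y : ℤ}
    (hx : x < y) (h : ∀ k, x ≤ k → k < y → k ∈ P.simpleRoots s) :
    ∃ lo hi, P.IsComponent s lo hi ∧ lo ≤ x ∧ y ≤ hi := by
  have hy : x + 1 ≤ y := hx
  clear hx
  induction y, hy using Int.leInduction with
  | base =>
    obtain ⟨lo, hi, h1, h2, h3⟩ := h x le_rfl (by omega)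
    exact ⟨lo, hi, h1, h2, h3⟩
  | succ y hy ih =>
    obtain ⟨lo, hi, h1, h2, h3⟩ := ih fun k hk1 hk2 => h k hk1 (by omega)
    obtain ⟨lo', hi', h1', h2', h3'⟩ := h y (by omega) (by omega)
    have hm : y ∈ Finset.Icc lo hi := Finset.mem_Icc.2 ⟨by omega, h3⟩
    have hm' : y ∈ Finset.Icc lo' hi' := Finset.mem_Icc.2 ⟨h2', by omega⟩
    have heq := (P.part s).eq_of_mem_parts h1.2 h1'.2 hm hm'
    have : y + 1 ∈ Finset.Icc lo hi := by
      rw [heq]; exact Finset.mem_Icc.2 ⟨by omega, h3'⟩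
    exact ⟨lo, hi, h1, h2, (Finset.mem_Icc.1 this).2⟩

theorem DoublePartition.exists_component_of_not_isNil {n : ℕ} (P : DoublePartition n) (s : Bool)
    {x y : ℤ} (hx : 1 ≤ x) (hxy : x < y) (hy : y ≤ n) (h : ¬ P.IsNil x y) :
    ∃ lo hi, P.IsComponent s lo hi ∧ lo ≤ x ∧ y ≤ hi := by
  refine P.exists_component s hxy fun k hk1 hk2 => ?_
  by_contra hk
  refine h ⟨k, by rwa [min_eq_left hxy.le], by rwa [max_eq_right hxy.le], ?_⟩
  have : k ∈ Set.Ico (1 : ℤ) n := ⟨by omega, by omega⟩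
  cases s
  · exact Or.inr ⟨this, hk⟩
  · exact Or.inl ⟨this, hk⟩

theorem DoublePartition.isNil_comm {n : ℕ} (P : DoublePartition n) (x y : ℤ) :
    P.IsNil x y ↔ P.IsNil y x := by
  unfold DoublePartition.IsNil
  rw [min_comm, max_comm]

/-- If `x < y` and `σ^s` moves `x` to the left and `y` to the right, then `ε_x - ε_y` is nil. -/
theorem DoublePartition.IsModified.isNil {n : ℕ} {P : DoublePartition n} {M : Set (Bool × ℤ)}
    {σ : Bool → Equiv.Perm ℤ} (hσ : P.IsModified M σ) (s : Bool) {x y : ℤ} (hxy : x < y)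
    (hx : σ s x < x) (hy : y < σ s y) : P.IsNil x y := by
  by_contra h
  have hmem : ∀ z, σ s z ≠ z → 1 ≤ z ∧ z ≤ n := by
    intro z hz
    by_contra hz'
    exact hz ((hσ s).2.1 z hz')
  have h1 := hmem x hx.ne
  have h2 := hmem y hy.ne'
  -- A non-nil root keeps `x` and `y` in one component, where the bounds give `lo + hi ≤ 2 * x < 2 *
  -- y ≤ lo + hi`.
  obtain ⟨lo, hi, hc, h3, h4⟩ := P.exists_component_of_not_isNil s h1.1 hxy h2.2 h
  have hA := (hσ s).2.2 lo hi hc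
  have := (hA.bounds h3 (by omega)).2 hx
  have := (hA.bounds (by omega) h4).1 hy
  omega

/-- The orientation of the arcs joining consecutive points of a walk. -/
def orient (f : ℕ → ℤ) (w : ℕ → Bool) (t : ℕ) : Bool := decide (f t < f (t + 1) ↔ w t = true)

theorem orient_eq_true {f : ℕ → ℤ} {w : ℕ → Bool} {t : ℕ} :
    orient f w t = true ↔ (f t < f (t + 1) ↔ w t = true) := by
  unfold orient; exact decide_eq_true_iff

theorem orient_eq_false {f : ℕ → ℤ} {w : ℕ → Bool} {t : ℕ} :
    orient f w t = false ↔ ¬ (f t < f (t + 1) ↔ w t = true) := by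
  unfold orient; exact decide_eq_false_iff_not

theorem dirArc_iff {σ : Bool → Equiv.Perm ℤ} {p q : ℤ} :
    DirArc σ p q ↔ p ≠ q ∧ ∃ c, σ c p = q ∧ (p < q ↔ c = true) := by
  unfold DirArc
  constructor
  · rintro (⟨h1, h2⟩ | ⟨h1, h2⟩)
    · exact ⟨h1.ne, true, h2, by simp [h1]⟩
    · exact ⟨h1.ne', false, h2, by simp [h1.le]⟩
  · rintro ⟨h1, c, h2, h3⟩
    cases c
    · simp only [Bool.false_eq_true, iff_false, not_lt] at h3
      exact Or.inr ⟨lt_of_le_of_ne h3 h1.symm, h2⟩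
    · exact Or.inl ⟨h3.2 rfl, h2⟩

/-! ### Dictionary between the edge and the oriented path -/

namespace IsWalk

variable {σ : Bool → Equiv.Perm ℤ} {E : Set ℤ} {m : ℕ} {f : ℕ → ℤ} {w : ℕ → Bool}

theorem injOn (h : IsWalk σ E m f w) {i j : ℕ} (hi : 1 ≤ i ∧ i ≤ m) (hj : 1 ≤ j ∧ j ≤ m)
    (hij : f i = f j) : i = j := h.bijOn.injOn hi hj hij

theorem ne_succ (h : IsWalk σ E m f w) {t : ℕ} (h1 : 1 ≤ t) (h2 : t < m) : f t ≠ f (t + 1) :=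
  fun he => by
    have := h.injOn ⟨h1, h2.le⟩ ⟨by omega, h2⟩ he
    omega

theorem pred (h : IsWalk σ E m f w) {t : ℕ} (h1 : 1 ≤ t) : σ (w t) (f (t + 1)) = f t := by
  rw [h.succ t h1, h.invol]

theorem pred' (h : IsWalk σ E m f w) {t : ℕ} (h1 : 2 ≤ t) : σ (!w t) (f t) = f (t - 1) := by
  have := h.pred (t := t - 1) (by omega)
  have hs := h.sign_succ (t - 1) (by omega)
  rw [Nat.sub_add_cancel (by omega)] at this hs
  rw [hs, Bool.not_not, this]

theorem dirArc_map_iff (h : IsWalk σ E m f w) {i j : ℕ} (hi : 1 ≤ i ∧ i ≤ m)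
    (hj : 1 ≤ j ∧ j ≤ m) : DirArc σ (f i) (f j) ↔
      (j = i + 1 ∧ orient f w i = true) ∨ (i = j + 1 ∧ orient f w j = false) := by
  rw [dirArc_iff]
  constructor
  · rintro ⟨hne, c, h1, h2⟩
    by_cases hc : c = w i
    · subst hc
      have him : i ≠ m := by
        rintro rfl
        rw [h.last] at h1
        exact hne h1
      rw [← h.succ i hi.1] at h1
      have := h.injOn ⟨by omega, by omega⟩ hj h1
      subst this
      exact Or.inl ⟨rfl, orient_eq_true.2 h2⟩
    · have hc' : c = !w i := by revert hc; cases c <;> cases w i <;> simp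
      have hi2 : i ≠ 1 := by
        rintro rfl
        rw [hc', h.first] at h1
        exact hne h1
      rw [hc', h.pred' (by omega)] at h1
      have := h.injOn ⟨by omega, by omega⟩ hj h1
      obtain rfl : i = j + 1 := by omega
      refine Or.inr ⟨rfl, orient_eq_false.2 ?_⟩
      rw [hc', h.sign_succ j hj.1, Bool.not_not] at h2
      rw [← h2]
      omega
  · rintro (⟨rfl, ho⟩ | ⟨rfl, ho⟩)
    · exact ⟨h.ne_succ hi.1 (by omega), w i, (h.succ i hi.1).symm, orient_eq_true.1 ho⟩
    · refine ⟨(h.ne_succ hj.1 (by omega)).symm, w j, h.pred hj.1, ?_⟩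
      have := orient_eq_false.1 ho
      have hne := h.ne_succ hj.1 (by omega)
      by_cases hw : w j = true
      · simp only [hw, iff_true] at this ⊢
        omega
      · simp only [hw, Bool.false_eq_true, iff_false, not_lt] at this ⊢
        omega

theorem mem (h : IsWalk σ E m f w) {t : ℕ} (ht : 1 ≤ t ∧ t ≤ m) : f t ∈ E := h.bijOn.mapsTo ht

theorem exists_of_dirArc (h : IsWalk σ E m f w) {p q : ℤ} (hpq : DirArc σ p q) :
    (p ∈ E ↔ q ∈ E) := by
  obtain ⟨-, c, rfl, -⟩ := dirArc_iff.1 hpq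
  exact (h.closed c p).symm

theorem exists_eq (h : IsWalk σ E m f w) {p : ℤ} (hp : p ∈ E) :
    ∃ t, (1 ≤ t ∧ t ≤ m) ∧ f t = p := h.bijOn.surjOn hp

/-- At an interior position each involution moves the point to one of its neighbours. This
identifies `b` with the last point. -/
theorem eq_last_of_fixed (h : IsWalk σ E m f w) {b : ℤ} (hb : b ∈ E) (hb1 : b ≠ f 1) {c : Bool}
    (hc : σ c b = b) : b = f m := by
  obtain ⟨t, ht, rfl⟩ := h.exists_eq hb
  by_contra hne
  have htm : t < m := lt_of_le_of_ne ht.2 (by rintro rfl; exact hne rfl)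
  have ht1 : t ≠ 1 := by rintro rfl; exact hb1 rfl
  by_cases hcw : c = w t
  · rw [hcw, ← h.succ t ht.1] at hc
    exact h.ne_succ ht.1 htm hc.symm
  · have hc' : c = !w t := by revert hcw; cases c <;> cases w t <;> simp
    rw [hc', h.pred' (by omega)] at hc
    have := h.injOn ⟨by omega, by omega⟩ ht hc
    omega

/-- Arcs lie alternately above and below the line, so the arrow flips exactly when the horizontal
motion keeps its direction. -/
theorem turn_iff (h : IsWalk σ E m f w) {t : ℕ} (h2 : 2 ≤ t) (htm : t < m) :
    orient f w (t - 1) ≠ orient f w t ↔ (f (t - 1) < f t ↔ f t < f (t + 1)) := by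
  obtain ⟨k, rfl⟩ := Nat.exists_eq_add_of_le' (by omega : 1 ≤ t)
  rw [Nat.add_sub_cancel]
  have hs := h.sign_succ k (by omega)
  unfold orient
  rw [hs]
  by_cases h1 : f k < f (k + 1) <;> by_cases h3 : f (k + 1) < f (k + 1 + 1) <;>
    cases w k <;> simp [h1, h3]

theorem mem_internalTP_iff {a : ℤ} (h : IsWalk σ E m (phi σ a) w) {t : ℕ} :
    t ∈ internalTP σ a m ↔ Turn (orient (phi σ a) w) m t := by
  have key : 2 ≤ t → t < m →
      (Int.sign (phi σ a t - phi σ a (t - 1)) ≠ Int.sign (phi σ a t - phi σ a (t + 1)) ↔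
        orient (phi σ a) w (t - 1) ≠ orient (phi σ a) w t) := by
    intro h2 htm
    rw [h.turn_iff h2 htm]
    have n1 := h.ne_succ (t := t - 1) (by omega) (by omega)
    rw [Nat.sub_add_cancel (by omega)] at n1
    have n2 := h.ne_succ (t := t) (by omega) htm
    rcases lt_or_gt_of_ne n1 with h1 | h1 <;> rcases lt_or_gt_of_ne n2 with h3 | h3
    · rw [Int.sign_eq_one_of_pos (by omega), Int.sign_eq_neg_one_of_neg (by omega)]
      simp [h1, h3]
    · rw [Int.sign_eq_one_of_pos (by omega), Int.sign_eq_one_of_pos (by omega)]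
      simp [h1, h3.le]
    · rw [Int.sign_eq_neg_one_of_neg (by omega), Int.sign_eq_neg_one_of_neg (by omega)]
      simp [h1.le, h3]
    · rw [Int.sign_eq_neg_one_of_neg (by omega), Int.sign_eq_one_of_pos (by omega)]
      simp [h3.le, h1.not_gt]
  constructor
  · rintro ⟨h1, h2, h3⟩
    exact ⟨h1, by omega, (key h1 (by omega)).1 h3⟩
  · rintro ⟨h1, h2, h3⟩
    exact ⟨h1, by omega, (key h1 h2).2 h3⟩

theorem mem_turningPoints_iff {a : ℤ} (h : IsWalk σ E m (phi σ a) w) {t : ℕ} :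
    t ∈ turningPoints σ a m ↔ t = 1 ∨ t = m ∨ Turn (orient (phi σ a) w) m t := by
  unfold turningPoints
  rw [Set.mem_union, h.mem_internalTP_iff]
  simp only [Set.mem_insert_iff, Set.mem_singleton_iff, or_assoc]

theorem mem_TP_iff {a : ℤ} (h : IsWalk σ E m (phi σ a) w) {c : Bool} {t : ℕ} :
    t ∈ TP σ a m c ↔ Typ (orient (phi σ a) w) m c t := by
  have htwo := h.two_le
  have hle : t ∈ turningPoints σ a m → 1 ≤ t ∧ t ≤ m := by
    rw [h.mem_turningPoints_iff]
    rintro (rfl | rfl | h)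
    · omega
    · omega
    · exact ⟨by have := h.1; omega, h.2.1.le⟩
  have htp : Typ (orient (phi σ a) w) m c t → t ∈ turningPoints σ a m := by
    rw [h.mem_turningPoints_iff]
    intro ht
    by_cases h1 : t = 1
    · exact Or.inl h1
    · by_cases h2 : t = m
      · exact Or.inr (Or.inl h2)
      · exact Or.inr (Or.inr (ht.turn (by have := ht.1; omega) (lt_of_le_of_ne ht.2.1 h2)))
  have hend : ∀ {p q}, DirArc σ p q → 1 ≤ t ∧ t ≤ m → (p = phi σ a t ∨ q = phi σ a t) →
      ∃ i j, (1 ≤ i ∧ i ≤ m) ∧ (1 ≤ j ∧ j ≤ m) ∧ p = phi σ a i ∧ q = phi σ a j ∧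
        (i = t ∨ j = t) := by
    intro p q hpq ht hor
    have hE := h.exists_of_dirArc hpq
    rcases hor with rfl | rfl
    · obtain ⟨j, hj, rfl⟩ := h.exists_eq (hE.1 (h.mem ht))
      exact ⟨t, j, ht, hj, rfl, rfl, Or.inl rfl⟩
    · obtain ⟨i, hi, rfl⟩ := h.exists_eq (hE.2 (h.mem ht))
      exact ⟨i, t, hi, ht, rfl, rfl, Or.inr rfl⟩
  cases c
  · constructor
    · rintro ⟨ht, hall⟩
      obtain ⟨h1, h2⟩ := hle ht
      refine ⟨h1, h2, fun h3 => ?_, fun h3 => ?_⟩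
      · by_contra hd
        have := hall _ _ ((h.dirArc_map_iff (i := t) (j := t - 1) ⟨h1, h2⟩
          ⟨by omega, by omega⟩).2 (Or.inr ⟨by omega, by simpa using hd⟩)) (Or.inl rfl)
        have := h.injOn ⟨by omega, by omega⟩ ⟨h1, h2⟩ this
        omega
      · by_contra hd
        have := hall _ _ ((h.dirArc_map_iff (i := t) (j := t + 1) ⟨h1, h2⟩
          ⟨by omega, by omega⟩).2 (Or.inl ⟨by omega, by simpa using hd⟩)) (Or.inl rfl)
        have := h.injOn ⟨by omega, by omega⟩ ⟨h1, h2⟩ this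
        omega
    · intro ht
      refine ⟨htp ht, fun p q hpq hor => ?_⟩
      obtain ⟨i, j, hi, hj, rfl, rfl, hij⟩ := hend hpq ⟨ht.1, ht.2.1⟩ hor
      have h3 := ht.2.2.1
      have h4 := ht.2.2.2
      rcases hij with rfl | rfl
      · rcases (h.dirArc_map_iff hi hj).1 hpq with ⟨rfl, ho⟩ | ⟨rfl, ho⟩
        · rw [h4 (by omega)] at ho
          simp at ho
        · have := h3 (by omega)
          rw [Nat.add_sub_cancel, ho] at this
          simp at this
      · rfl
  · constructor
    · rintro ⟨ht, hall⟩
      obtain ⟨h1, h2⟩ := hle ht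
      refine ⟨h1, h2, fun h3 => ?_, fun h3 => ?_⟩
      · by_contra hd
        have := hall _ _ ((h.dirArc_map_iff (i := t - 1) (j := t) ⟨by omega, by omega⟩
          ⟨h1, h2⟩).2 (Or.inl ⟨by omega, by simpa using hd⟩)) (Or.inr rfl)
        have := h.injOn ⟨by omega, by omega⟩ ⟨h1, h2⟩ this
        omega
      · by_contra hd
        have := hall _ _ ((h.dirArc_map_iff (i := t + 1) (j := t) ⟨by omega, by omega⟩
          ⟨h1, h2⟩).2 (Or.inr ⟨by omega, by simpa using hd⟩)) (Or.inr rfl)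
        have := h.injOn ⟨by omega, by omega⟩ ⟨h1, h2⟩ this
        omega
    · intro ht
      refine ⟨htp ht, fun p q hpq hor => ?_⟩
      obtain ⟨i, j, hi, hj, rfl, rfl, hij⟩ := hend hpq ⟨ht.1, ht.2.1⟩ hor
      have h3 := ht.2.2.1
      have h4 := ht.2.2.2
      rcases hij with rfl | rfl
      · rfl
      · rcases (h.dirArc_map_iff hi hj).1 hpq with ⟨rfl, ho⟩ | ⟨rfl, ho⟩
        · have := h3 (by omega)
          rw [Nat.add_sub_cancel, ho] at this
          simp at this
        · rw [h4 (by omega)] at ho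
          simp at ho

variable {a : ℤ} {sg : ℕ → ℤˣ}

theorem mem_negTP_iff (h : IsWalk σ E m (phi σ a) w) {c : Bool} {t : ℕ} :
    t ∈ negTP σ a m sg c ↔ Neg (orient (phi σ a) w) sg c t ∧ t < m := by
  unfold negTP
  rw [Set.mem_ofPred_eq, h.mem_internalTP_iff, h.mem_TP_iff]
  constructor
  · rintro ⟨h1, h2, h3⟩
    exact ⟨⟨h1.1, h1.2.2, h2.2.2.2 h1.2.1, h3⟩, h1.2.1⟩
  · rintro ⟨⟨h1, h2, h3, h4⟩, h5⟩
    have ht : Turn (orient (phi σ a) w) m t := ⟨h1, h5, h2⟩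
    exact ⟨ht, ht.typ h3, h4⟩

theorem isLeast_TP_iff (h : IsWalk σ E m (phi σ a) w) {c : Bool} {r s : ℕ} :
    IsLeast {u ∈ TP σ a m c | r < u} s ↔ First (orient (phi σ a) w) m c r s := by
  unfold First
  simp only [h.mem_TP_iff]

theorem isLeast_TP_iff' (h : IsWalk σ E m (phi σ a) w) {c : Bool} {s : ℕ} :
    IsLeast (TP σ a m c) s ↔ First (orient (phi σ a) w) m c 0 s := by
  rw [← h.isLeast_TP_iff]
  congr! 1
  ext u
  simp only [Set.mem_ofPred_eq]
  constructor
  · exact fun hu => ⟨hu, (h.mem_TP_iff.1 hu).1⟩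
  · exact fun hu => hu.1

/-- The conventional value `r = 0` absorbs the case without negative points, since all positions are
at least `1`. -/
theorem exists_lastNeg_first_iff (h : IsWalk σ E m (phi σ a) w) {c c' : Bool} {t s : ℕ}
    (ht : t ≤ m) :
    ((∃ r, IsGreatest {r ∈ negTP σ a m sg c | r < t} r ∧ IsLeast {u ∈ TP σ a m c' | r < u} s) ∨
      ({r ∈ negTP σ a m sg c | r < t} = ∅ ∧ IsLeast (TP σ a m c') s)) ↔
    ∃ r, LastNeg (orient (phi σ a) w) sg c t r ∧ First (orient (phi σ a) w) m c' r s := by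
  have hset : {r ∈ negTP σ a m sg c | r < t} = {r | Neg (orient (phi σ a) w) sg c r ∧ r < t} := by
    ext r
    simp only [Set.mem_ofPred_eq, h.mem_negTP_iff]
    constructor
    · rintro ⟨⟨h1, -⟩, h2⟩
      exact ⟨h1, h2⟩
    · rintro ⟨h1, h2⟩
      exact ⟨⟨h1, by omega⟩, h2⟩
  rw [hset, h.isLeast_TP_iff']
  simp only [h.isLeast_TP_iff]
  unfold LastNeg
  constructor
  · rintro (⟨r, h1, h2⟩ | ⟨h1, h2⟩)
    · exact ⟨r, Or.inl h1, h2⟩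
    · exact ⟨0, Or.inr ⟨h1, rfl⟩, h2⟩
  · rintro ⟨r, h1 | ⟨h1, rfl⟩, h2⟩
    · exact Or.inl ⟨r, h1, h2⟩
    · exact Or.inr ⟨h1, h2⟩

theorem crosses_iff (h : IsWalk σ E m (phi σ a) w) {t s : ℕ}
    (ht : Turn (orient (phi σ a) w) m t) :
    Crosses σ a m sg (orient (phi σ a) w t) t s ↔ Cross (orient (phi σ a) w) sg m t s := by
  unfold Crosses Cross
  rw [h.exists_lastNeg_first_iff ht.2.1.le, h.isLeast_TP_iff]

theorem extremal_iff (h : IsWalk σ E m (phi σ a) w) {c : Bool} {s : ℕ} :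
    Extremal (orient (phi σ a) w) sg m c s ↔
      (∃ r, IsGreatest (negTP σ a m sg (!c)) r ∧ IsLeast {u ∈ TP σ a m c | r < u} s) ∨
        (negTP σ a m sg (!c) = ∅ ∧ IsLeast (TP σ a m c) s) := by
  unfold Extremal
  rw [← h.exists_lastNeg_first_iff le_rfl]
  have hset : {r ∈ negTP σ a m sg (!c) | r < m} = negTP σ a m sg (!c) := by
    ext r
    simp only [Set.mem_ofPred_eq, and_iff_left_iff_imp]
    exact fun hr => (h.mem_negTP_iff.1 hr).2
  rw [hset]

theorem outerEnd_mem {t : ℕ} (g : ℕ → ℤˣ) (h2 : 2 ≤ t) (htm : t < m) :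
    1 ≤ outerEnd g t ∧ outerEnd g t ≤ m ∧ (outerEnd g t + 1 = t ∨ outerEnd g t = t + 1) := by
  unfold outerEnd
  split_ifs <;> omega

theorem dirArc_outerEnd (h : IsWalk σ E m (phi σ a) w) {t : ℕ} (g : ℕ → ℤˣ)
    (ht : Turn (orient (phi σ a) w) m t) :
    (DirArc σ (phi σ a t) (phi σ a (outerEnd g t)) ↔ orient (phi σ a) w t = true) ∧
    (DirArc σ (phi σ a (outerEnd g t)) (phi σ a t) ↔ orient (phi σ a) w t = false) := by
  obtain ⟨h1, h2, h3⟩ := outerEnd_mem g ht.1 ht.2.1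
  have ht' : 1 ≤ t ∧ t ≤ m := ⟨by have := ht.1; omega, ht.2.1.le⟩
  rw [h.dirArc_map_iff ht' ⟨h1, h2⟩, h.dirArc_map_iff ⟨h1, h2⟩ ht']
  have hne := ht.2.2
  rcases h3 with h3 | h3
  · rw [show t - 1 = outerEnd g t by omega] at hne
    have e1 : ¬ outerEnd g t = t + 1 := by omega
    simp only [e1, h3, true_and, false_and, or_false, false_or]
    revert hne
    cases orient (phi σ a) w t <;> cases orient (phi σ a) w (outerEnd g t) <;> simp
  · have e1 : ¬ t = t + 1 + 1 := by omega
    simp only [h3, e1, true_and, false_and, or_false, false_or, and_self]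

theorem starArc_iff (h : IsWalk σ E m (phi σ a) w) {p q : ℤ} :
    StarArc σ a m sg p q ↔ ∃ i j, (1 ≤ i ∧ i ≤ m) ∧ (1 ≤ j ∧ j ≤ m) ∧ p = phi σ a i ∧
      q = phi σ a j ∧ Star (orient (phi σ a) w) sg m i j := by
  constructor
  · rintro (⟨k, h1, h2, h3, h4, h5⟩ | ⟨t, ht, c, s, htc, hcr, h5⟩)
    · have h3' : ∀ t, Turn (orient (phi σ a) w) m t → markedIndex sg t ≠ k :=
        fun t ht => h3 t (h.mem_internalTP_iff.2 ht)
      have hk : 1 ≤ k ∧ k ≤ m := ⟨h1, by omega⟩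
      have hk' : 1 ≤ k + 1 ∧ k + 1 ≤ m := ⟨by omega, by omega⟩
      rcases h5 with ⟨rfl, rfl⟩ | ⟨rfl, rfl⟩
      · refine ⟨k, k + 1, hk, hk', rfl, rfl, Or.inl ⟨k, h1, h2, h3', Or.inl ⟨?_, rfl, rfl⟩⟩⟩
        rcases (h.dirArc_map_iff hk hk').1 h4 with ⟨-, h4⟩ | ⟨h4, -⟩
        · exact h4
        · omega
      · refine ⟨k + 1, k, hk', hk, rfl, rfl, Or.inl ⟨k, h1, h2, h3', Or.inr ⟨?_, rfl, rfl⟩⟩⟩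
        rcases (h.dirArc_map_iff hk' hk).1 h4 with ⟨h4, -⟩ | ⟨-, h4⟩
        · omega
        · exact h4
    · rw [h.mem_internalTP_iff] at ht
      rw [h.mem_TP_iff] at htc
      obtain rfl := htc.2.2.2 ht.2.1
      rw [h.crosses_iff ht] at hcr
      obtain ⟨h1, h2, -⟩ := outerEnd_mem sg ht.1 ht.2.1
      have hs := hcr.typ
      rw [(h.dirArc_outerEnd sg ht).1, (h.dirArc_outerEnd sg ht).2] at h5
      rcases h5 with ⟨h5, rfl, rfl⟩ | ⟨h5, rfl, rfl⟩
      · exact ⟨s, outerEnd sg t, ⟨hs.1, hs.2.1⟩, ⟨h1, h2⟩, rfl, rfl,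
          Or.inr ⟨t, s, ht, hcr, Or.inl ⟨h5, rfl, rfl⟩⟩⟩
      · exact ⟨outerEnd sg t, s, ⟨h1, h2⟩, ⟨hs.1, hs.2.1⟩, rfl, rfl,
          Or.inr ⟨t, s, ht, hcr, Or.inr ⟨h5, rfl, rfl⟩⟩⟩
  · rintro ⟨i, j, hi, hj, rfl, rfl, ⟨k, h1, h2, h3, h4⟩ | ⟨t, s, ht, hcr, h5⟩⟩
    · refine Or.inl ⟨k, h1, h2, fun t ht => h3 t (h.mem_internalTP_iff.1 ht), ?_⟩
      rcases h4 with ⟨h4, rfl, rfl⟩ | ⟨h4, rfl, rfl⟩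
      · exact ⟨(h.dirArc_map_iff hi hj).2 (Or.inl ⟨rfl, h4⟩), Or.inl ⟨rfl, rfl⟩⟩
      · exact ⟨(h.dirArc_map_iff hi hj).2 (Or.inr ⟨rfl, h4⟩), Or.inr ⟨rfl, rfl⟩⟩
    · refine Or.inr ⟨t, h.mem_internalTP_iff.2 ht, _, s, h.mem_TP_iff.2 (ht.typ rfl),
        (h.crosses_iff ht).2 hcr, ?_⟩
      rw [(h.dirArc_outerEnd sg ht).1, (h.dirArc_outerEnd sg ht).2]
      rcases h5 with ⟨h5, rfl, rfl⟩ | ⟨h5, rfl, rfl⟩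
      · exact Or.inl ⟨h5, rfl, rfl⟩
      · exact Or.inr ⟨h5, rfl, rfl⟩

/-- A short arc between two internal turning points is nil, hence is not marked twice. -/
theorem not_marked_twice {n : ℕ} {P : DoublePartition n} {M : Set (Bool × ℤ)}
    (hσ : P.IsModified M σ) (h : IsWalk σ E m (phi σ a) w) (hsg : P.IsSignature σ a m sg) {t : ℕ}
    (h1 : Turn (orient (phi σ a) w) m t) (h2 : Turn (orient (phi σ a) w) m (t + 1))
    (hs1 : sg t = -1) : sg (t + 1) ≠ 1 := by
  intro hs2
  -- Two successive turning points make four successive points monotone, so the involution other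
  -- than the one joining `φ(t)` to `φ(t+1)` moves these two outwards.
  have hnil : P.NilValue σ a t := by
    have e1 := (h.turn_iff h1.1 h1.2.1).1 h1.2.2
    have e2 := (h.turn_iff h2.1 h2.2.1).1 h2.2.2
    rw [Nat.add_sub_cancel] at e2
    have n2 := h.ne_succ (t := t) (by have := h1.1; omega) h1.2.1
    have n3 := h.ne_succ (t := t + 1) (by omega) h2.2.1
    have n1 := h.ne_succ (t := t - 1) (by have := h1.1; omega) (by have := h1.2.1; omega)
    rw [Nat.sub_add_cancel (by have := h1.1; omega)] at n1
    have s1 := h.pred' h1.1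
    have s2 := h.succ (t + 1) (by omega)
    rw [h.sign_succ t (by have := h1.1; omega)] at s2
    unfold DoublePartition.NilValue
    rcases lt_or_gt_of_ne n2 with hlt | hlt
    · refine hσ.isNil (!w t) hlt ?_ ?_
      · rw [s1]; exact e1.2 hlt
      · rw [← s2]; exact e2.1 hlt
    · rw [P.isNil_comm]
      refine hσ.isNil (!w t) hlt ?_ ?_
      · rw [← s2]; omega
      · rw [s1]; omega
  have hs := hsg t (h.mem_internalTP_iff.2 h1)
  -- Once `β_t` is nil, the signature rule imposes the positive sign whether or not `β_{t-1}` is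
  -- nil.
  have h3 : sg t = 1 := by
    by_cases hn : P.NilValue σ a (t - 1)
    · exact hs.2.2 hn hnil
    · exact hs.2.1 hn hnil
  rw [hs1] at h3
  exact absurd h3 (by decide)

end IsWalk

/-! ### Enumeration of the straightened edge and properties of its ends -/

theorem IsPathRel.exists_enum {m : ℕ} {R : ℕ → ℕ → Prop} {s f : ℕ} (h : IsPathRel m R s f) :
    ∃ θ : ℕ → ℕ, Set.BijOn θ (Set.Icc 1 m) (Set.Icc 1 m) ∧
      (∀ i j, R i j ↔ ∃ k, 1 ≤ k ∧ k < m ∧ i = θ k ∧ j = θ (k + 1)) ∧ θ 1 = s ∧ θ m = f := by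
  obtain ⟨l, h1, h2, h3, h4, h5⟩ := h
  have hlen : l.length = m := by
    rw [← List.toFinset_card_of_nodup h1]
    have : l.toFinset = Finset.Icc 1 m := by
      ext x
      simp [h2]
    rw [this, Nat.card_Icc]
    omega
  have hget : ∀ k (hk : k < l.length), l.getD k 0 = l[k] := fun k hk => by
    simp [List.getD, hk]
  refine ⟨fun k => l.getD (k - 1) 0, ⟨fun k hk => ?_, fun k hk k' hk' he => ?_, fun x hx => ?_⟩,
    fun i j => ?_, ?_, ?_⟩
  · have hk1 := hk.1
    have hk2 := hk.2
    simp only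
    rw [hget (k - 1) (by omega)]
    exact (h2 _).1 (List.getElem_mem _)
  · have hk1 := hk.1
    have hk2 := hk.2
    have hk1' := hk'.1
    have hk2' := hk'.2
    simp only at he
    rw [hget (k - 1) (by omega), hget (k' - 1) (by omega)] at he
    have := (h1.getElem_inj_iff).1 he
    omega
  · obtain ⟨k, hk, rfl⟩ := List.getElem_of_mem ((h2 x).2 hx)
    refine ⟨k + 1, ⟨by omega, by omega⟩, ?_⟩
    simp only [Nat.add_sub_cancel]
    exact hget k hk
  · rw [h3, consec_iff_getElem]
    constructor
    · rintro ⟨k, hk, rfl, rfl⟩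
      refine ⟨k + 1, by omega, by omega, ?_, ?_⟩
      · simp only [Nat.add_sub_cancel]; exact (hget k (by omega)).symm
      · simp only [Nat.add_sub_cancel]; exact (hget (k + 1) hk).symm
    · rintro ⟨k, hk1, hk2, rfl, rfl⟩
      obtain ⟨k, rfl⟩ := Nat.exists_eq_add_of_le' hk1
      refine ⟨k, by omega, ?_, ?_⟩
      · simp only [Nat.add_sub_cancel]; exact hget k (by omega)
      · simp only [Nat.add_sub_cancel]; exact hget (k + 1) (by omega)
  · simp only [Nat.sub_self, List.getD, ← List.head?_eq_getElem?, h4, Option.getD_some]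
  · simp only [List.getD, ← hlen, ← List.getLast?_eq_getElem?, h5, Option.getD_some]

/-- The arcs alone determine the ends: the start is the point with no incoming arc, the finish the
one with no outgoing arc. -/
theorem IsStraightening.eq_ends {σ : Bool → Equiv.Perm ℤ} {a : ℤ} {E : Set ℤ} {sg : ℕ → ℤˣ}
    {ψ ψ' : ℕ → ℤ} (h : IsStraightening σ a E sg ψ) (h' : IsStraightening σ a E sg ψ')
    (hE : 1 < E.ncard) : ψ 1 = ψ' 1 ∧ ψ E.ncard = ψ' E.ncard := by
  obtain ⟨hb, ha⟩ := h
  obtain ⟨hb', ha'⟩ := h'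
  constructor
  · obtain ⟨j, hj, he⟩ := hb'.surjOn (hb.mapsTo (⟨le_rfl, hE.le⟩ : 1 ∈ Set.Icc 1 E.ncard))
    have hj1 := hj.1
    have hj2 := hj.2
    by_cases h1 : j = 1
    · rw [← he, h1]
    · exfalso
      have harc := (ha' (ψ' (j - 1)) (ψ' j)).2 ⟨j - 1, by omega, by omega, rfl, by
        rw [Nat.sub_add_cancel hj1]⟩
      obtain ⟨k, hk1, hk2, -, hk4⟩ := (ha _ _).1 harc
      rw [he] at hk4
      have := hb.injOn ⟨le_rfl, hE.le⟩ ⟨by omega, by omega⟩ hk4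
      omega
  · obtain ⟨j, hj, he⟩ := hb'.surjOn (hb.mapsTo (⟨hE.le, le_rfl⟩ : E.ncard ∈ Set.Icc 1 E.ncard))
    have hj1 := hj.1
    have hj2 := hj.2
    by_cases h1 : j = E.ncard
    · rw [← he, h1]
    · exfalso
      have harc := (ha' (ψ' j) (ψ' (j + 1))).2 ⟨j, by omega, by omega, rfl, rfl⟩
      obtain ⟨k, hk1, hk2, hk3, -⟩ := (ha _ _).1 harc
      rw [he] at hk3
      have := hb.injOn ⟨hE.le, le_rfl⟩ ⟨by omega, by omega⟩ hk3
      omega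

namespace IsWalk

variable {σ : Bool → Equiv.Perm ℤ} {E : Set ℤ} {w : ℕ → Bool} {a : ℤ} {sg : ℕ → ℤˣ}

theorem exists_isStraightening {s f : ℕ} (h : IsWalk σ E E.ncard (phi σ a) w)
    (hp : IsPathRel E.ncard (Star (orient (phi σ a) w) sg E.ncard) s f) :
    ∃ ψ, IsStraightening σ a E sg ψ ∧ ψ 1 = phi σ a s ∧ ψ E.ncard = phi σ a f := by
  obtain ⟨θ, h1, h2, h3, h4⟩ := hp.exists_enum
  refine ⟨fun j => phi σ a (θ j), ⟨h.bijOn.comp h1, fun p q => ?_⟩, by simp only [h3],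
    by simp only [h4]⟩
  rw [h.starArc_iff]
  constructor
  · rintro ⟨i, j, -, -, rfl, rfl, hs⟩
    obtain ⟨k, hk1, hk2, rfl, rfl⟩ := (h2 i j).1 hs
    exact ⟨k, hk1, hk2, rfl, rfl⟩
  · rintro ⟨k, hk1, hk2, rfl, rfl⟩
    exact ⟨θ k, θ (k + 1), h1.mapsTo ⟨hk1, hk2.le⟩, h1.mapsTo ⟨by omega, hk2⟩, rfl, rfl,
      (h2 _ _).2 ⟨k, hk1, hk2, rfl, rfl⟩⟩

/-- The properties of the end of type `c` of the straightened edge. -/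
theorem end_properties {m : ℕ} (h : IsWalk σ E m (phi σ a) w) {c : Bool} {s : ℕ}
    (hs : Extremal (orient (phi σ a) w) sg m c s) :
    phi σ a s ∈ phi σ a '' TP σ a m c ∧
    ((negTP σ a m sg (!c)).Nonempty → ∃ r u, IsGreatest (negTP σ a m sg (!c)) r ∧
      IsLeast {u ∈ turningPoints σ a m | r < u} u ∧ u ∈ TP σ a m c ∧ phi σ a s = phi σ a u) ∧
    (negTP σ a m sg (!c) = ∅ → ∃ u, IsLeast (TP σ a m c) u ∧ phi σ a s = phi σ a u) ∧
    (phi σ a s = phi σ a 1 ↔ phi σ a 1 ∈ phi σ a '' TP σ a m c ∧ negTP σ a m sg (!c) = ∅) ∧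
    (phi σ a s = phi σ a m ↔ phi σ a m ∈ phi σ a '' TP σ a m c ∧
      ((internalTP σ a m).Nonempty →
        ∃ p, IsGreatest (internalTP σ a m ∩ TP σ a m (!c)) p ∧ sg p = -1)) := by
  have hm := h.two_le
  have htyp : Typ (orient (phi σ a) w) m c s := by
    obtain ⟨r, -, hr⟩ := hs
    exact hr.1.1
  have hmem : ∀ t, 1 ≤ t ∧ t ≤ m →
      (phi σ a t ∈ phi σ a '' TP σ a m c ↔ Typ (orient (phi σ a) w) m c t) := by
    intro t ht
    constructor
    · rintro ⟨u, hu, he⟩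
      rw [h.mem_TP_iff] at hu
      obtain rfl := h.injOn ⟨hu.1, hu.2.1⟩ ht he
      exact hu
    · exact fun hu => ⟨t, h.mem_TP_iff.2 hu, rfl⟩
  have heq : ∀ t, 1 ≤ t ∧ t ≤ m → (phi σ a s = phi σ a t ↔ s = t) := fun t ht =>
    ⟨fun he => h.injOn ⟨htyp.1, htyp.2.1⟩ ht he, fun he => by rw [he]⟩
  refine ⟨⟨s, h.mem_TP_iff.2 htyp, rfl⟩, fun hne => ?_, fun hemp => ?_, ?_, ?_⟩
  · rcases h.extremal_iff.1 hs with ⟨r, hr, hrs⟩ | ⟨hemp, -⟩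
    · refine ⟨r, s, hr, ?_, h.mem_TP_iff.2 htyp, rfl⟩
      have hr' := h.mem_negTP_iff.1 hr.1
      have := (h.isLeast_TP_iff.1 hrs).isLeast_turning ⟨hr'.1.1, hr'.2, hr'.1.2.1⟩ hr'.1.2.2.1
      simpa only [h.mem_turningPoints_iff] using this
    · rw [hemp] at hne
      exact absurd hne Set.not_nonempty_empty
  · rcases h.extremal_iff.1 hs with ⟨r, hr, -⟩ | ⟨-, hleast⟩
    · exact absurd hr.1 (by rw [hemp]; simp)
    · exact ⟨s, hleast, rfl⟩
  · rw [heq 1 ⟨le_rfl, by omega⟩, hmem 1 ⟨le_rfl, by omega⟩, hs.eq_one_iff,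
      Set.eq_empty_iff_forall_notMem]
    simp only [h.mem_negTP_iff, not_and]
    exact and_congr_right fun _ => forall_congr' fun t => imp_not_comm
  · rw [heq m ⟨by omega, le_rfl⟩, hmem m ⟨by omega, le_rfl⟩, hs.eq_last_iff hm]
    have hset : internalTP σ a m ∩ TP σ a m (!c) =
        {t | Turn (orient (phi σ a) w) m t ∧ orient (phi σ a) w t = !c} := by
      ext t
      rw [Set.mem_inter_iff, h.mem_internalTP_iff, h.mem_TP_iff]
      exact and_congr_right fun ht => ⟨fun h1 => h1.2.2.2 ht.2.1, fun h1 => ht.typ h1⟩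
    rw [hset]
    simp only [Set.Nonempty, h.mem_internalTP_iff]

end IsWalk

end Biparabolic

theorem proposition8p2 (n : ℕ) (hn : 1 < n) (P : DoublePartition n)
    (hunion : P.simpleRoots true ∪ P.simpleRoots false = Set.Ico (1 : ℤ) n)
    (hproper : P.simpleRoots true ∩ P.simpleRoots false ⊂ Set.Ico (1 : ℤ) n)
    (M : Set (Bool × ℤ)) (hM : P.IsMarking M)
    (σ : Bool → Equiv.Perm ℤ) (hσ : P.IsModified M σ)
    (E : Set ℤ) (hE : IsEdge (σ true) (σ false) E) (hE1 : 1 < E.ncard)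
    (a b : ℤ) (ha : a ∈ E) (hb : b ∈ E) (hab : a ≠ b)
    (ha' : σ true a = a ∨ σ false a = a) (hb' : σ true b = b ∨ σ false b = b)
    (sg : ℕ → ℤˣ) (hsg : P.IsSignature σ a E.ncard sg) :
    (∃ ψ, IsStraightening σ a E sg ψ) ∧
    ∀ ψ, IsStraightening σ a E sg ψ → ∀ astar bstar, astar = ψ 1 → bstar = ψ E.ncard →
      -- (i)
      (astar ∈ phi σ a '' TP σ a E.ncard true ∧ bstar ∈ phi σ a '' TP σ a E.ncard false) ∧
      -- (ii)
      ((negTP σ a E.ncard sg false).Nonempty →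
        ∃ m s, IsGreatest (negTP σ a E.ncard sg false) m ∧
          IsLeast {u ∈ turningPoints σ a E.ncard | m < u} s ∧
          s ∈ TP σ a E.ncard true ∧ astar = phi σ a s) ∧
      (negTP σ a E.ncard sg false = ∅ →
        ∃ s, IsLeast (TP σ a E.ncard true) s ∧ astar = phi σ a s) ∧
      -- (iii)
      ((negTP σ a E.ncard sg true).Nonempty →
        ∃ m s, IsGreatest (negTP σ a E.ncard sg true) m ∧
          IsLeast {u ∈ turningPoints σ a E.ncard | m < u} s ∧
          s ∈ TP σ a E.ncard false ∧ bstar = phi σ a s) ∧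
      (negTP σ a E.ncard sg true = ∅ →
        ∃ s, IsLeast (TP σ a E.ncard false) s ∧ bstar = phi σ a s) ∧
      -- (iv)
      (astar = a ↔ a ∈ phi σ a '' TP σ a E.ncard true ∧ negTP σ a E.ncard sg false = ∅) ∧
      -- (v)
      (astar = b ↔ b ∈ phi σ a '' TP σ a E.ncard true ∧
        ((internalTP σ a E.ncard).Nonempty →
          ∃ m, IsGreatest (internalTP σ a E.ncard ∩ TP σ a E.ncard false) m ∧ sg m = -1)) ∧
      -- (vi)
      (bstar = a ↔ a ∈ phi σ a '' TP σ a E.ncard false ∧ negTP σ a E.ncard sg true = ∅) ∧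
      -- (vii)
      (bstar = b ↔ b ∈ phi σ a '' TP σ a E.ncard false ∧
        ((internalTP σ a E.ncard).Nonempty →
          ∃ m, IsGreatest (internalTP σ a E.ncard ∩ TP σ a E.ncard true) m ∧ sg m = -1)) := by
  obtain ⟨w, hw, hphi1⟩ := exists_isWalk (fun c => (hσ c).1) hE.1 hE1 ha ha'
  obtain ⟨s, f, hs, hf, hp⟩ := starIsPath (g := sg) hw.two_le fun t h1 h2 =>
    hw.not_marked_twice hσ hsg h1 h2
  obtain ⟨ψ₀, hψ₀, hψs, hψf⟩ := hw.exists_isStraightening hp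
  have hbe : b = phi σ a E.ncard := by
    have hb1 : b ≠ phi σ a 1 := by rw [hphi1]; exact hab.symm
    rcases hb' with h | h <;> exact hw.eq_last_of_fixed hb hb1 h
  refine ⟨⟨ψ₀, hψ₀⟩, ?_⟩
  rintro ψ hψ _ _ rfl rfl
  -- An arbitrary straightening has the same ends as the constructed one, for which they are known.
  obtain ⟨e1, e2⟩ := hψ.eq_ends hψ₀ hE1
  rw [e1, e2, hψs, hψf]
  obtain ⟨s1, s2, s3, s4, s5⟩ := hw.end_properties hs
  obtain ⟨f1, f2, f3, f4, f5⟩ := hw.end_properties hf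
  rw [hphi1] at s4 f4
  rw [← hbe] at s5 f5
  exact ⟨⟨s1, f1⟩, s2, s3, f2, f3, s4, s5, f4, f5⟩
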